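/- Let $M$ be a complex manifold of complex dimension $n\geq 2$ and let $\Omega\subset M$ be a relatively compact pseudoconvex domain with $C^3$ boundary; pseudoconvex means that $\partial\bar\partial\rho(Z,\bar Z)\geq 0$ for all $P\in\partial\Omega$ and $Z\in T^{1,0}_P(\partial\Omega)$, where $\rho$ is any $C^2$ defining function for $\Omega$ on a neighborhood of $\partial\Omega$ (negative in $\Omega$, zero on $\partial\Omega$, positive outside $\overline\Omega$, with $d\rho\neq 0$ on $\partial\Omega$) and $T^{1,0}_P(\partial\Omega)=\{Z\in T^{1,0}_P(M):\partial\rho(Z)=0\}$. For $P\in\partial\Omega$ let $\mathcal N_P(\partial\Omega)$ be the null space of the Levi form, i.e. the set of all $Z\in T^{1,0}_P(\partial\Omega)$ such that $\partial\bar\partial\rho(Z,\bar W)=0$ for all $W\in T^{1,0}_P(\partial\Omega)$, where $\rho$ is any $C^2$ defining function for $\Omega$. Let $r\in C^3(U)$ be a defining function for $\Omega$ on some open neighborhood $U$ of $\partial\Omega$, and let $\langle\cdot,\cdot\rangle_0$ and $\langle\cdot,\cdot\rangle_1$ be two (smooth) Hermitian metrics on $M$. For $j\in\{0,1\}$ let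 $L_r^j$ be the unique section of $T^{1,0}(M)$ near $\partial\Omega$ satisfying $$|\partial r|_j^{-2}\,\partial r(Z)=\langle Z,L_r^j\rangle_j\quad\text{for all } Z\in T^{1,0}(M),$$ let $\alpha_r^j$ be the real $1$-form given by $$\alpha_r^j(Z)=\partial\bar\partial r(Z,\overline{L_r^j}),\qquad \alpha_r^j(\bar Z)=\partial\bar\partial r(L_r^j,\bar Z)\quad\text{for all } Z\in T^{1,0}(M),$$ and let $\beta_r^j=-\frac{i}{2}\left(\partial\alpha_r^j-\bar\partial\alpha_r^j\right)$. Then for every $P\in\partial\Omega$ and all $Z,W\in\mathcal N_P(\partial\Omega)$, $$\alpha_r^1(Z)=\alpha_r^0(Z)\qquad\text{and}\qquad \beta_r^1(Z,\bar W)=\beta_r^0(Z,\bar W)\quad\text{at }P.$$ -/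

import Mathlib

open Set Topology
open scoped Manifold ContDiff ComplexConjugate

noncomputable section

namespace LeviGeometry

/-! ### Complexified tangent vectors

`M` is a complex manifold modelled on the finite-dimensional complex vector space `E`. The real
tangent space `T_p M` is `TangentSpace 𝓘(ℂ, E) p`; its complex structure `J` is multiplication by
`Complex.I`. The holomorphic tangent space `T^{1,0}_p M` inside `ℂ ⊗ T_p M` is identified with
`(T_p M, J)` by the usual complex-linear isomorphism `v ↦ Z_v = (v - i J v) / 2`. -/

section Complexification

variable {T : Type*} [AddCommGroup T] [Module ℂ T]

/-- Elements `x + i y` of the complexification `ℂ ⊗ T` of the real vector space underlying `T`,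
written as pairs `(x, y)`. -/
abbrev Complexified (T : Type*) : Type _ := T × T

/-- Complex conjugation `x + i y ↦ x - i y` on the complexification. -/
def conjVec (X : Complexified T) : Complexified T := (X.1, -X.2)

/-- The vector `Z_v = (v - i J v) / 2` of type `(1,0)` that corresponds to `v`. -/
def holVec (v : T) : Complexified T := ((1 / 2 : ℝ) • v, -((1 / 2 : ℝ) • (Complex.I • v)))

variable [TopologicalSpace T]

/-- Value of a complex-valued real `1`-form on a complexified vector, by `ℂ`-linear extension. -/
def eval₁ (a : T →L[ℝ] ℂ) (X : Complexified T) : ℂ := a X.1 + Complex.I * a X.2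

/-- Value of a complex-valued real `2`-form on two complexified vectors, by `ℂ`-bilinear
extension. -/
def eval₂ (b : T [⋀^Fin 2]→L[ℝ] ℂ) (X Y : Complexified T) : ℂ :=
  b ![X.1, Y.1] + Complex.I * b ![X.1, Y.2] + Complex.I * b ![X.2, Y.1] - b ![X.2, Y.2]

/-- The values of a `1`-form on vectors of type `(1,0)` are complex-linear. -/
theorem eval₁_holVec_add_smul (a : T →L[ℝ] ℂ) (c : ℂ) (v w : T) :
    eval₁ a (holVec (v + c • w)) = eval₁ a (holVec v) + c * eval₁ a (holVec w) := by
  have key : ∀ (x y : ℝ) (u : T), ((x : ℂ) + y * Complex.I) • u = x • u + y • (Complex.I • u) := by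
    intro x y u
    rw [add_smul, mul_smul, Complex.coe_smul, Complex.coe_smul]
  have key' : ∀ (x y : ℝ) (u : T), Complex.I • (x • u + y • (Complex.I • u))
      = x • (Complex.I • u) - y • u := by
    intro x y u
    rw [smul_add, smul_comm, smul_comm Complex.I y, smul_smul Complex.I Complex.I,
      Complex.I_mul_I, neg_one_smul, smul_neg, sub_eq_add_neg]
  rw [← Complex.re_add_im c]
  simp only [eval₁, holVec, key, smul_add, key', smul_sub, map_add, map_sub, map_neg, map_smul,
    Complex.real_smul]
  push_cast
  linear_combination (1 / 2 : ℂ) * c.im * a (Complex.I • w) * Complex.I_sq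

theorem form2_add_left (b : T [⋀^Fin 2]→L[ℝ] ℂ) (x y w : T) :
    b ![x + y, w] = b ![x, w] + b ![y, w] := b.vecCons_add ![w] x y

theorem form2_smul_left (b : T [⋀^Fin 2]→L[ℝ] ℂ) (c : ℝ) (x w : T) :
    b ![c • x, w] = c • b ![x, w] := b.vecCons_smul ![w] c x

theorem form2_swap (b : T [⋀^Fin 2]→L[ℝ] ℂ) (x w : T) : b ![x, w] = -b ![w, x] := by
  have h := b.toAlternatingMap.map_swap ![w, x] (i := 0) (j := 1) (by decide)
  have e : ![w, x] ∘ Equiv.swap (0 : Fin 2) 1 = ![x, w] := by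
    ext i; fin_cases i <;> rfl
  rw [e] at h
  exact h

theorem form2_add_right (b : T [⋀^Fin 2]→L[ℝ] ℂ) (w x y : T) :
    b ![w, x + y] = b ![w, x] + b ![w, y] := by
  rw [form2_swap, form2_add_left, form2_swap b w x, form2_swap b w y]; ring

theorem form2_smul_right (b : T [⋀^Fin 2]→L[ℝ] ℂ) (c : ℝ) (w x : T) :
    b ![w, c • x] = c • b ![w, x] := by
  rw [form2_swap, form2_smul_left, form2_swap b w x, smul_neg]

variable [ContinuousConstSMul ℂ T]

/-- The complex structure `J` as a real-linear map. -/
def J : T →L[ℝ] T where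
  toFun v := Complex.I • v
  map_add' := smul_add _
  map_smul' c v := smul_comm _ c v
  cont := continuous_const_smul _

/-- The `1`-form `v ↦ b(Z_v, L̄) + b(L, Z̄_v)` for a `2`-form `b` and `L` of type `(1,0)`. -/
def contract (b : T [⋀^Fin 2]→L[ℝ] ℂ) (L : T) : T →L[ℝ] ℂ where
  toFun v := eval₂ b (holVec v) (conjVec (holVec L)) + eval₂ b (holVec L) (conjVec (holVec v))
  map_add' v w := by
    simp only [eval₂, holVec, conjVec, smul_add, neg_add, neg_neg, form2_add_left,
      form2_add_right]
    ring
  map_smul' c v := by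
    have h1 : ∀ (x y z : ℝ) (u : T), x • (y • u) = y • (x • u) := fun x y _ u => smul_comm x y u
    have h2 : ∀ (x : ℝ) (u : T), Complex.I • (x • u) = x • (Complex.I • u) :=
      fun x u => smul_comm _ x u
    simp only [eval₂, holVec, conjVec, h2, ← smul_neg, form2_smul_left, form2_smul_right,
      RingHom.id_apply, Complex.real_smul]
    ring
  cont := by
    have hc : Continuous (fun v : T => Complex.I • v) := continuous_const_smul _
    have nl : ∀ x w : T, b ![-x, w] = -b ![x, w] := fun x w => by
      rw [← neg_one_smul ℝ x, form2_smul_left, neg_one_smul]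
    have nr : ∀ x w : T, b ![w, -x] = -b ![w, x] := fun x w => by
      rw [← neg_one_smul ℝ x, form2_smul_right, neg_one_smul]
    simp only [eval₂, holVec, conjVec, nl, nr, form2_smul_left, form2_smul_right]
    have hl : ∀ w : T, Continuous fun v : T => b ![v, w] := fun w =>
      (b.toContinuousMultilinearMap.toContinuousLinearMap ![0, w] 0).cont.congr
        fun v => congrArg b (by ext i; fin_cases i <;> rfl)
    have hr : ∀ w : T, Continuous fun v : T => b ![w, v] := fun w =>
      (b.toContinuousMultilinearMap.toContinuousLinearMap ![w, 0] 1).cont.congr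
        fun v => congrArg b (by ext i; fin_cases i <;> rfl)
    have hl' := fun w => (hl w).comp hc
    have hr' := fun w => (hr w).comp hc
    simp only [Function.comp_def] at hl' hr'
    fun_prop

variable [IsTopologicalAddGroup T]

/-- The `(1,0)` part of a `1`-form: `X ↦ a(X^{1,0})`. -/
def part10 (a : T →L[ℝ] ℂ) : T →L[ℝ] ℂ :=
  (1 / 2 : ℂ) • (a - Complex.I • a.comp J)

/-- The `(0,1)` part of a `1`-form: `X ↦ a(X^{0,1})`. -/
def part01 (a : T →L[ℝ] ℂ) : T →L[ℝ] ℂ :=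
  (1 / 2 : ℂ) • (a + Complex.I • a.comp J)

/-- The `2`-form `(v, w) ↦ b(J v, w) + b(v, J w)`, obtained by polarization of pull-backs. -/
def derivJ (b : T [⋀^Fin 2]→L[ℝ] ℂ) : T [⋀^Fin 2]→L[ℝ] ℂ :=
  b.compContinuousLinearMap (ContinuousLinearMap.id ℝ T + J) - b - b.compContinuousLinearMap J

/-- The `(2,0)` part of a `2`-form: `(X, Y) ↦ b(X^{1,0}, Y^{1,0})`. -/
def part20 (b : T [⋀^Fin 2]→L[ℝ] ℂ) : T [⋀^Fin 2]→L[ℝ] ℂ :=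
  (1 / 4 : ℂ) • (b - b.compContinuousLinearMap J - Complex.I • derivJ b)

/-- The `(1,1)` part of a `2`-form: `(X, Y) ↦ b(X^{1,0}, Y^{0,1}) + b(X^{0,1}, Y^{1,0})`. -/
def part11 (b : T [⋀^Fin 2]→L[ℝ] ℂ) : T [⋀^Fin 2]→L[ℝ] ℂ :=
  (1 / 2 : ℂ) • (b + b.compContinuousLinearMap J)

/-- The `(0,2)` part of a `2`-form: `(X, Y) ↦ b(X^{0,1}, Y^{0,1})`. -/
def part02 (b : T [⋀^Fin 2]→L[ℝ] ℂ) : T [⋀^Fin 2]→L[ℝ] ℂ :=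
  (1 / 4 : ℂ) • (b - b.compContinuousLinearMap J + Complex.I • derivJ b)

end Complexification

/-! ### The operators `d`, `∂`, `∂̄` on a complex manifold -/

section Manifold

variable {E : Type*} [NormedAddCommGroup E] [NormedSpace ℂ E]
variable {M : Type*} [TopologicalSpace M] [ChartedSpace E M]

variable (E M) in
/-- Complex-valued (not necessarily continuous) `1`-forms on `M`. -/
abbrev Form1 : Type _ := ∀ p : M, TangentSpace 𝓘(ℂ, E) p →L[ℝ] ℂ

variable (E M) in
/-- Complex-valued (not necessarily continuous) `2`-forms on `M`. -/
abbrev Form2 : Type _ := ∀ p : M, TangentSpace 𝓘(ℂ, E) p [⋀^Fin 2]→L[ℝ] ℂ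

/-- The (real-linear) derivative at `q` of the preferred chart around `p`. -/
def chartDeriv (p q : M) : TangentSpace 𝓘(ℂ, E) q →L[ℝ] E :=
  (mfderiv 𝓘(ℂ, E) 𝓘(ℂ, E) (chartAt E p) q).restrictScalars ℝ

/-- The derivative at `x : E` of the inverse of the preferred chart around `p`. -/
def chartSymmDeriv (p : M) (x : E) :
    E →L[ℂ] TangentSpace 𝓘(ℂ, E) ((chartAt E p).symm x) :=
  mfderiv 𝓘(ℂ, E) 𝓘(ℂ, E) (chartAt E p).symm x

/-- The coordinate expression of a `1`-form in the preferred chart around `p`. -/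
def inChart (a : Form1 E M) (p : M) (x : E) : E →L[ℝ] ℂ :=
  (a ((chartAt E p).symm x)).comp ((chartSymmDeriv p x).restrictScalars ℝ)

/-- The differential `df` of a real function. -/
def d₀ (f : M → ℝ) : Form1 E M := fun p =>
  (Complex.ofRealCLM.comp (fderiv ℝ (f ∘ (chartAt E p).symm) (chartAt E p p))).comp
    (chartDeriv p p)

/-- The exterior derivative of a `1`-form, computed in holomorphic coordinates;
`da(X, Y) = X a(Y) - Y a(X) - a([X, Y])`. -/
def d₁ (a : Form1 E M) : Form2 E M := fun p =>
  (extDeriv (fun x => ContinuousAlternatingMap.ofSubsingleton ℝ E ℂ (0 : Fin 1) (inChart a p x))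
    (chartAt E p p)).compContinuousLinearMap (chartDeriv p p)

/-- `∂f` for a real function `f`. -/
def del₀ (f : M → ℝ) : Form1 E M := fun p => part10 (d₀ f p)

/-- `∂̄f` for a real function `f`. -/
def delbar₀ (f : M → ℝ) : Form1 E M := fun p => part01 (d₀ f p)

/-- `∂a` for a `1`-form `a`: the sum of the `(2,0)` part of `d(a^{1,0})` and the `(1,1)` part of
`d(a^{0,1})`. -/
def del₁ (a : Form1 E M) : Form2 E M := fun p =>
  part20 (d₁ (fun q => part10 (a q)) p) + part11 (d₁ (fun q => part01 (a q)) p)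

/-- `∂̄a` for a `1`-form `a`: the sum of the `(1,1)` part of `d(a^{1,0})` and the `(0,2)` part of
`d(a^{0,1})`. -/
def delbar₁ (a : Form1 E M) : Form2 E M := fun p =>
  part11 (d₁ (fun q => part10 (a q)) p) + part02 (d₁ (fun q => part01 (a q)) p)

/-- The complex Hessian `∂∂̄f`. -/
def ddbar (f : M → ℝ) : Form2 E M := del₁ (delbar₀ f)

/-! ### Domains, defining functions and the Levi form -/

variable (E) in
/-- `ρ` is a `C^k` defining function for `Ω` on the open neighbourhood `U` of `∂Ω`. -/
structure IsDefiningFunction (k : WithTop ℕ∞) (Ω U : Set M) (ρ : M → ℝ) : Prop where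
  isOpen : IsOpen U
  frontier_subset : frontier Ω ⊆ U
  contMDiffOn : ContMDiffOn 𝓘(ℝ, E) 𝓘(ℝ, ℝ) k ρ U
  neg : ∀ p ∈ U ∩ Ω, ρ p < 0
  zero : ∀ p ∈ frontier Ω, ρ p = 0
  pos : ∀ p ∈ U \ closure Ω, 0 < ρ p
  d_ne_zero : ∀ p ∈ frontier Ω, d₀ (E := E) ρ p ≠ 0

/-- For a defining function `ρ` of `Ω` and `p ∈ ∂Ω`: the space `T^{1,0}_p(∂Ω)` of vectors
`Z ∈ T^{1,0}_p M` with `∂ρ(Z) = 0`. -/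
def holTangent (ρ : M → ℝ) (p : M) : Set (TangentSpace 𝓘(ℂ, E) p) :=
  {Z | eval₁ (del₀ ρ p) (holVec Z) = 0}

variable (E) in
/-- Pseudoconvexity of a domain with `C^2` boundary: the Levi form of a defining function is
nonnegative on `T^{1,0}(∂Ω)`. -/
def IsPseudoconvex (Ω : Set M) : Prop :=
  ∀ (U : Set M) (ρ : M → ℝ), IsDefiningFunction E 2 Ω U ρ →
    ∀ p ∈ frontier Ω, ∀ Z ∈ holTangent (E := E) ρ p,
      0 ≤ (eval₂ (ddbar ρ p) (holVec Z) (conjVec (holVec Z))).re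

/-- The null space `𝒩_p(∂Ω)` of the Levi form at `p ∈ ∂Ω`: all `Z ∈ T^{1,0}_p(∂Ω)` such that
`∂∂̄ρ(Z, W̄) = 0` for all `W ∈ T^{1,0}_p(∂Ω)`, where `ρ` is any `C^2` defining function. -/
def leviNull (Ω : Set M) (p : M) : Set (TangentSpace 𝓘(ℂ, E) p) :=
  {Z | ∀ (U : Set M) (ρ : M → ℝ), IsDefiningFunction E 2 Ω U ρ →
    Z ∈ holTangent (E := E) ρ p ∧
      ∀ W ∈ holTangent (E := E) ρ p,
        eval₂ (ddbar ρ p) (holVec Z) (conjVec (holVec W)) = 0}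

/-! ### Hermitian metrics and the forms `α_r`, `β_r` -/

variable (E M) in
/-- A smooth Hermitian metric on `M`: `inner p v w = ⟨Z_v, Z_w⟩` is a positive definite Hermitian
form on `T^{1,0}_p M`, linear in the first and conjugate-linear in the second variable, with smooth
coefficients in every preferred chart. -/
structure HermitianMetric where
  inner (p : M) : TangentSpace 𝓘(ℂ, E) p →ₗ[ℂ] TangentSpace 𝓘(ℂ, E) p →ₗ⋆[ℂ] ℂ
  conj_symm (p : M) (v w : TangentSpace 𝓘(ℂ, E) p) : conj (inner p w v) = inner p v w
  pos (p : M) (v : TangentSpace 𝓘(ℂ, E) p) : v ≠ 0 → 0 < (inner p v v).re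
  smooth (p : M) (v w : E) : ContDiffOn ℝ ∞
    (fun x => inner ((chartAt E p).symm x) (chartSymmDeriv p x v) (chartSymmDeriv p x w))
    (chartAt E p).target

/-- The norm `|∂r|` at `p`, dual to the metric on `T^{1,0}_p M`. -/
def normDel (g : HermitianMetric E M) (r : M → ℝ) (p : M) : ℝ :=
  sSup {t | ∃ Z : TangentSpace 𝓘(ℂ, E) p,
    (g.inner p Z Z).re ≤ 1 ∧ t = ‖eval₁ (del₀ r p) (holVec Z)‖}

/-- The condition `|∂r|⁻² ∂r(Z) = ⟨Z, L⟩` for all `Z ∈ T^{1,0}_p M`. -/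
def IsComplexNormal (g : HermitianMetric E M) (r : M → ℝ) (p : M)
    (L : TangentSpace 𝓘(ℂ, E) p) : Prop :=
  ∀ Z : TangentSpace 𝓘(ℂ, E) p,
    (((normDel g r p ^ 2)⁻¹ : ℝ) : ℂ) * eval₁ (del₀ r p) (holVec Z) = g.inner p Z L

theorem existsUnique_isComplexNormal [FiniteDimensional ℂ E] (g : HermitianMetric E M)
    (r : M → ℝ) (p : M) : ∃! L, IsComplexNormal g r p L := by
  have : FiniteDimensional ℂ (TangentSpace 𝓘(ℂ, E) p) := inferInstanceAs (FiniteDimensional ℂ E)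
  let φ : TangentSpace 𝓘(ℂ, E) p →ₗ[ℝ] Module.Dual ℂ (TangentSpace 𝓘(ℂ, E) p) :=
    { toFun := fun L => (g.inner p).flip L
      map_add' := fun x y => map_add _ x y
      map_smul' := fun c x => by
        rw [← Complex.coe_smul c x, map_smulₛₗ, Complex.conj_ofReal]
        rfl }
  have hinj : Function.Injective φ := by
    rw [injective_iff_map_eq_zero]
    intro L hL
    by_contra hne
    have h := g.pos p L hne
    have h0 : g.inner p L L = 0 := by
      simpa [φ] using congrArg (fun f : Module.Dual ℂ (TangentSpace 𝓘(ℂ, E) p) => f L) hL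
    simp [h0] at h
  have hsurj : Function.Surjective φ := by
    refine (LinearMap.injective_iff_surjective_of_finrank_eq_finrank ?_).1 hinj
    rw [finrank_real_of_complex, finrank_real_of_complex, Subspace.dual_finrank_eq]
  let F : Module.Dual ℂ (TangentSpace 𝓘(ℂ, E) p) :=
    { toFun := fun Z => (((normDel g r p ^ 2)⁻¹ : ℝ) : ℂ) * eval₁ (del₀ r p) (holVec Z)
      map_add' := fun x y => by
        have := eval₁_holVec_add_smul (del₀ r p) 1 x y
        rw [one_smul] at this
        rw [this]; ring
      map_smul' := fun c x => by
        have := eval₁_holVec_add_smul (del₀ r p) c 0 x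
        have h0 : eval₁ (del₀ r p) (holVec (0 : TangentSpace 𝓘(ℂ, E) p)) = 0 := by
          simp [eval₁, holVec]
        rw [zero_add, h0, zero_add] at this
        rw [this]; simp; ring }
  obtain ⟨L, hL⟩ := hsurj F
  refine ⟨L, fun Z => ?_, fun L' hL' => hinj ?_⟩
  · simpa [φ, F] using (congrArg (fun f : Module.Dual ℂ (TangentSpace 𝓘(ℂ, E) p) => f Z) hL).symm
  · rw [hL]
    ext Z
    simpa [φ, F] using (hL' Z).symm

variable [FiniteDimensional ℂ E]

/-- The section `L_r` of `T^{1,0}M`: the unique solution of `|∂r|⁻² ∂r(Z) = ⟨Z, L_r⟩` for all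
`Z ∈ T^{1,0}M`. -/
def Lr (g : HermitianMetric E M) (r : M → ℝ) (p : M) : TangentSpace 𝓘(ℂ, E) p :=
  (existsUnique_isComplexNormal g r p).choose

/-- The `1`-form `α_r` with `α_r(Z) = ∂∂̄r(Z, L̄_r)` and `α_r(Z̄) = ∂∂̄r(L_r, Z̄)` for `Z` of type
`(1,0)`; thus `α_r(v) = ∂∂̄r(Z_v, L̄_r) + ∂∂̄r(L_r, Z̄_v)` for a real vector `v = Z_v + Z̄_v`. -/
def alpha (g : HermitianMetric E M) (r : M → ℝ) : Form1 E M := fun p =>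
  contract (ddbar r p) (Lr g r p)

/-- The `2`-form `β_r = -(i/2) (∂α_r - ∂̄α_r)`. -/
def beta (g : HermitianMetric E M) (r : M → ℝ) : Form2 E M := fun p =>
  (-(Complex.I / 2)) • (del₁ (alpha g r) p - delbar₁ (alpha g r) p)

end Manifold

end LeviGeometry

end

noncomputable section

namespace LeviGeometry

/-! Write `ρ` for `r` in the preferred chart at `P`, and `H` for the complex Hessian of `ρ`. In the
chart both normals become `C¹` fields `N` (`chartNormal`) with `∂ρ(N) = 1`, and the metrics enter
only through these fields. So it is enough to compare two such fields `ℓ₀` and `ℓ₁`, whose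
difference `T` at `P` is a complex tangent vector.

For `α`: a null vector `Z` annihilates tangent vectors under `H`, so `H(Z, V̄)` depends on `V` only
through `∂ρ(V)`. In particular `α(Z) = H(Z, N̄)` is the same for both fields.

For `β`: the (1,1) component is `β(Z, W̄) = -(i/2) (∂_Z H(N, W̄) + conj (∂_W H(N, Z̄)))`
(`eval₂_beta`), so the claim is that `∂_Z H(N, W̄)` does not change with `N`. Since `W` is null, the
derivative of `N` contributes only through `∂ρ(dN)`. Differentiating `∂ρ(N) = 1` expresses this by
second derivatives of `ρ`. What remains of the difference is a third derivative of `ρ` in the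
directions `Z, T, W̄`, with a second-order correction. By symmetry of the derivatives `Z` and `T`
may be exchanged, and the remainder becomes the derivative of the Levi form on `(Z, W)` in the
tangential direction `T`.

That derivative vanishes by pseudoconvexity: if `S` is null and is extended to a tangential field,
the Levi form of the extension is nonnegative on `∂Ω` and zero at `P`, so it has a minimum along
`∂Ω` (`leviDeriv_self_eq_zero`). Polarization passes from `(S, S)` to `(Z, W)`
(`leviDeriv_eq_zero`). This use of third derivatives is where `C³` is needed.
`part10_fderiv_hermitianPart_normal_eq` carries out the comparison. The rest of the work identifies
the intrinsic objects with their coordinate expressions. -/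

theorem I_smul_I_smul {T : Type*} [AddCommGroup T] [Module ℂ T] (v : T) :
    Complex.I • Complex.I • v = -v := by
  rw [smul_smul, Complex.I_mul_I, neg_one_smul]

/-! ### Type decomposition of real linear and bilinear forms on a complex vector space. -/

section FlatAlgebra

variable {E : Type*} [NormedAddCommGroup E] [NormedSpace ℂ E]

/-- The `(1,0)` part `∂A(Z_v)` of a real covector. -/
def covector10 (A : E →L[ℝ] ℝ) (v : E) : ℂ :=
  (1 / 2) * ((A v : ℂ) - Complex.I * (A (Complex.I • v) : ℂ))

/-- The sesquilinear form `B(Z_v, Z̄_w)` attached to a real bilinear form. -/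
def hermitianPart (B : E →L[ℝ] E →L[ℝ] ℝ) (v w : E) : ℂ :=
  (1 / 4) * (((B v w : ℂ) + (B (Complex.I • v) (Complex.I • w) : ℂ))
    + Complex.I * ((B v (Complex.I • w) : ℂ) - (B (Complex.I • v) w : ℂ)))

/-- The bilinear form `B(Z_v, Z_w)` attached to a real bilinear form. -/
def bilinearPart (B : E →L[ℝ] E →L[ℝ] ℝ) (v w : E) : ℂ :=
  (1 / 2) * (covector10 (B v) w - Complex.I * covector10 (B (Complex.I • v)) w)

theorem complex_smul_eq (c : ℂ) (v : E) : c • v = c.re • v + c.im • (Complex.I • v) := by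
  conv_lhs => rw [← Complex.re_add_im c]
  rw [add_smul, mul_smul, Complex.coe_smul, Complex.coe_smul]

theorem I_smul_complex_smul (c : ℂ) (v : E) :
    Complex.I • c • v = c.re • (Complex.I • v) - c.im • v := by
  rw [smul_smul, mul_comm, mul_smul, complex_smul_eq c, I_smul_I_smul, smul_neg, sub_eq_add_neg]

theorem covector10_add (A : E →L[ℝ] ℝ) (v w : E) :
    covector10 A (v + w) = covector10 A v + covector10 A w := by
  simp only [covector10, smul_add, map_add, Complex.ofReal_add]; ring

theorem covector10_smul (A : E →L[ℝ] ℝ) (c : ℂ) (v : E) :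
    covector10 A (c • v) = c * covector10 A v := by
  simp only [covector10, I_smul_complex_smul]
  simp only [complex_smul_eq c v, map_add, map_sub, map_smul,
    smul_eq_mul]
  push_cast
  linear_combination (-(1 / 2 : ℂ) * ((A v : ℂ) - Complex.I * (A (Complex.I • v) : ℂ))) *
    (Complex.re_add_im c).symm + (1 / 2 : ℂ) * c.im * (A (Complex.I • v) : ℂ) * Complex.I_sq

theorem covector10_sub (A : E →L[ℝ] ℝ) (v w : E) :
    covector10 A (v - w) = covector10 A v - covector10 A w := by
  rw [sub_eq_add_neg, ← neg_one_smul ℂ w, covector10_add, covector10_smul]; ring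

theorem covector10_re (A : E →L[ℝ] ℝ) (v : E) : (covector10 A v).re = A v / 2 := by
  simp [covector10]; ring

theorem apply_eq_zero_of_covector10_eq_zero {A : E →L[ℝ] ℝ} {v : E} (h : covector10 A v = 0) :
    A v = 0 := by
  have := covector10_re A v
  rw [h, Complex.zero_re] at this
  linarith

theorem hermitianPart_add_left (B : E →L[ℝ] E →L[ℝ] ℝ) (u v w : E) :
    hermitianPart B (u + v) w = hermitianPart B u w + hermitianPart B v w := by
  simp only [hermitianPart, smul_add, map_add, add_apply, Complex.ofReal_add]
  ring

theorem hermitianPart_add_right (B : E →L[ℝ] E →L[ℝ] ℝ) (u v w : E) :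
    hermitianPart B u (v + w) = hermitianPart B u v + hermitianPart B u w := by
  simp only [hermitianPart, smul_add, map_add, Complex.ofReal_add]
  ring

theorem hermitianPart_smul_left (B : E →L[ℝ] E →L[ℝ] ℝ) (c : ℂ) (v w : E) :
    hermitianPart B (c • v) w = c * hermitianPart B v w := by
  conv_rhs => rw [← Complex.re_add_im c]
  simp only [hermitianPart, I_smul_complex_smul]
  simp only [complex_smul_eq c v, map_add, map_sub, map_smul,
    add_apply, sub_apply, smul_apply,
    smul_eq_mul]
  push_cast
  linear_combination (-(1 / 4 : ℂ) * c.im * ((B v (Complex.I • w) : ℂ)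
    - (B (Complex.I • v) w : ℂ))) * Complex.I_sq

theorem hermitianPart_conj {B : E →L[ℝ] E →L[ℝ] ℝ} (hB : ∀ v w, B v w = B w v) (v w : E) :
    conj (hermitianPart B v w) = hermitianPart B w v := by
  simp only [hermitianPart, map_mul, map_add, map_sub, Complex.conj_ofReal, Complex.conj_I,
    hB w v, hB (Complex.I • w), hB w (Complex.I • v)]
  simp only [map_div₀, map_one, map_ofNat]
  ring

theorem hermitianPart_smul_right (B : E →L[ℝ] E →L[ℝ] ℝ) (c : ℂ) (v w : E) :
    hermitianPart B v (c • w) = conj c * hermitianPart B v w := by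
  have hc : conj c = (c.re : ℂ) - c.im * Complex.I := by
    apply Complex.ext <;> simp
  rw [hc]
  simp only [hermitianPart, I_smul_complex_smul]
  simp only [complex_smul_eq c w, map_add, map_sub, map_smul,
    smul_eq_mul]
  push_cast
  linear_combination ((1 / 4 : ℂ) * c.im * ((B v (Complex.I • w) : ℂ)
    - (B (Complex.I • v) w : ℂ))) * Complex.I_sq

theorem hermitianPart_sub_left (B : E →L[ℝ] E →L[ℝ] ℝ) (u v w : E) :
    hermitianPart B (u - v) w = hermitianPart B u w - hermitianPart B v w := by
  rw [sub_eq_add_neg, ← neg_one_smul ℂ v, hermitianPart_add_left, hermitianPart_smul_left]; ring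

theorem hermitianPart_sub_right (B : E →L[ℝ] E →L[ℝ] ℝ) (u v w : E) :
    hermitianPart B u (v - w) = hermitianPart B u v - hermitianPart B u w := by
  rw [sub_eq_add_neg, ← neg_one_smul ℂ w, hermitianPart_add_right, hermitianPart_smul_right]
  simp; ring

theorem bilinearPart_comm {B : E →L[ℝ] E →L[ℝ] ℝ} (hB : ∀ v w, B v w = B w v) (v w : E) :
    bilinearPart B v w = bilinearPart B w v := by
  simp only [bilinearPart, covector10, hB w v, hB (Complex.I • w), hB w (Complex.I • v)]
  ring

/-- `∂∂̄` is obtained from `∂̄` by applying `∂`. -/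
theorem hermitianPart_eq (B : E →L[ℝ] E →L[ℝ] ℝ) (v w : E) :
    hermitianPart B v w
      = (1 / 2) * (conj (covector10 (B v) w) - Complex.I * conj (covector10 (B (Complex.I • v)) w)) := by
  simp only [hermitianPart, covector10, map_mul, map_sub, Complex.conj_ofReal, Complex.conj_I]
  simp only [map_div₀, map_one, map_ofNat]
  linear_combination (1 / 4 : ℂ) * (B (Complex.I • v) (Complex.I • w)) * Complex.I_sq

end FlatAlgebra

/-! ### Differentiation of the Levi form in coordinates. -/

section FlatCalculus

variable {E : Type*} [NormedAddCommGroup E] [NormedSpace ℂ E]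

theorem part10_apply {T : Type*} [AddCommGroup T] [Module ℂ T] [TopologicalSpace T]
    [ContinuousConstSMul ℂ T] (a : T →L[ℝ] ℂ) (v : T) :
    part10 a v = (1 / 2) * (a v - Complex.I * a (Complex.I • v)) := rfl

theorem part01_apply {T : Type*} [AddCommGroup T] [Module ℂ T] [TopologicalSpace T]
    [ContinuousConstSMul ℂ T] (a : T →L[ℝ] ℂ) (v : T) :
    part01 a v = (1 / 2) * (a v + Complex.I * a (Complex.I • v)) := rfl

theorem contDiffAt_hermitianPart {n : WithTop ℕ∞} {B : E → E →L[ℝ] E →L[ℝ] ℝ} {v w : E → E} {x : E}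
    (hB : ContDiffAt ℝ n B x) (hv : ContDiffAt ℝ n v x) (hw : ContDiffAt ℝ n w x) :
    ContDiffAt ℝ n (fun y => hermitianPart (B y) (v y) (w y)) x := by
  have key : ∀ {v w : E → E}, ContDiffAt ℝ n v x → ContDiffAt ℝ n w x →
      ContDiffAt ℝ n (fun y => (B y (v y) (w y) : ℂ)) x := fun hv hw =>
    Complex.ofRealCLM.contDiff.contDiffAt.comp x ((hB.clm_apply hv).clm_apply hw)
  have hv' : ContDiffAt ℝ n (fun y => Complex.I • v y) x := contDiffAt_const.smul hv
  have hw' : ContDiffAt ℝ n (fun y => Complex.I • w y) x := contDiffAt_const.smul hw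
  exact contDiffAt_const.mul (((key hv hw).add (key hv' hw')).add
    (contDiffAt_const.mul ((key hv hw').sub (key hv' hw))))

theorem hasFDerivAt_bilinear_apply {B : E → E →L[ℝ] E →L[ℝ] ℝ} {v w : E → E} {x : E}
    (hB : DifferentiableAt ℝ B x) (hv : DifferentiableAt ℝ v x) (hw : DifferentiableAt ℝ w x) :
    ∃ F : E →L[ℝ] ℂ, HasFDerivAt (fun y => (B y (v y) (w y) : ℂ)) F x ∧ ∀ u,
      F u = fderiv ℝ B x u (v x) (w x) + B x (fderiv ℝ v x u) (w x) + B x (v x) (fderiv ℝ w x u) := by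
  have h := Complex.ofRealCLM.hasFDerivAt.comp x
    ((hB.hasFDerivAt.clm_apply hv.hasFDerivAt).clm_apply hw.hasFDerivAt)
  refine ⟨_, h, fun u => ?_⟩
  simp
  ring

theorem fderiv_hermitianPart {B : E → E →L[ℝ] E →L[ℝ] ℝ} {v w : E → E} {x : E}
    (hB : DifferentiableAt ℝ B x) (hv : DifferentiableAt ℝ v x) (hw : DifferentiableAt ℝ w x)
    (u : E) :
    fderiv ℝ (fun y => hermitianPart (B y) (v y) (w y)) x u
      = hermitianPart (fderiv ℝ B x u) (v x) (w x) + hermitianPart (B x) (fderiv ℝ v x u) (w x)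
        + hermitianPart (B x) (v x) (fderiv ℝ w x u) := by
  have hI : ∀ {v : E → E}, DifferentiableAt ℝ v x → DifferentiableAt ℝ (fun y => Complex.I • v y) x ∧
      ∀ u, fderiv ℝ (fun y => Complex.I • v y) x u = Complex.I • fderiv ℝ v x u := by
    intro v hv
    have h := hv.hasFDerivAt.const_smul Complex.I
    exact ⟨h.differentiableAt, fun u =>
      congrArg (fun F : E →L[ℝ] E => F u) h.fderiv⟩
  obtain ⟨hv', ev⟩ := hI hv
  obtain ⟨hw', ew⟩ := hI hw
  obtain ⟨F₁, h₁, e₁⟩ := hasFDerivAt_bilinear_apply hB hv hw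
  obtain ⟨F₂, h₂, e₂⟩ := hasFDerivAt_bilinear_apply hB hv' hw'
  obtain ⟨F₃, h₃, e₃⟩ := hasFDerivAt_bilinear_apply hB hv hw'
  obtain ⟨F₄, h₄, e₄⟩ := hasFDerivAt_bilinear_apply hB hv' hw
  have h := ((h₁.add h₂).add ((h₃.sub h₄).const_mul Complex.I)).const_mul (1 / 4)
  have e := congrArg (fun F : E →L[ℝ] ℂ => F u) h.fderiv
  refine e.trans ?_
  simp only [add_apply, sub_apply, smul_apply, smul_eq_mul, e₁, e₂, e₃, e₄, ev, ew, hermitianPart]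
  ring

/-- Product rule for a constant pairing: the derivative of the vector field, paired with the
covector, is traded for the derivative of the covector. With `A = dρ` this removes every derivative
of a normal or tangential field. -/
theorem covector10_fderiv {A : E → E →L[ℝ] ℝ} {v : E → E} {x : E}
    (hA : DifferentiableAt ℝ A x) (hv : DifferentiableAt ℝ v x) {c : ℂ}
    (h : ∀ᶠ y in 𝓝 x, covector10 (A y) (v y) = c) (u : E) :
    covector10 (A x) (fderiv ℝ v x u) = -covector10 (fderiv ℝ A x u) (v x) := by
  have hcov : ∀ {w : E → E}, DifferentiableAt ℝ w x → ∃ F : E →L[ℝ] ℂ,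
      HasFDerivAt (fun y => (A y (w y) : ℂ)) F x ∧ ∀ u,
        F u = fderiv ℝ A x u (w x) + A x (fderiv ℝ w x u) := by
    intro w hw
    refine ⟨_, Complex.ofRealCLM.hasFDerivAt.comp x (hA.hasFDerivAt.clm_apply hw.hasFDerivAt),
      fun u => ?_⟩
    simp
    ring
  have hIv := hv.hasFDerivAt.const_smul Complex.I
  obtain ⟨F₁, h₁, e₁⟩ := hcov hv
  obtain ⟨F₂, h₂, e₂⟩ := hcov hIv.differentiableAt
  have hd := (h₁.sub (h₂.const_mul Complex.I)).const_mul (1 / 2)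
  have h0 := hd.unique ((hasFDerivAt_const c x).congr_of_eventuallyEq h)
  have e := congrArg (fun F : E →L[ℝ] ℂ => F u) h0
  have eI : fderiv ℝ (fun y => Complex.I • v y) x u = Complex.I • fderiv ℝ v x u :=
    congrArg (fun F : E →L[ℝ] E => F u) hIv.fderiv
  simp only [sub_apply, smul_apply, smul_eq_mul, e₁, e₂, zero_apply] at e
  erw [eI] at e
  simp only [covector10]
  linear_combination e

/-- The derivative of a function at a minimum on a level set of `f` vanishes on `ker df`. -/
theorem fderiv_apply_eq_zero_of_isMinOn_level [CompleteSpace E] {f φ : E → ℝ} {x : E}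
    (hf : ContDiffAt ℝ 1 f x) (hφ : ContDiffAt ℝ 1 φ x) (hd : fderiv ℝ f x ≠ 0)
    (hmin : ∀ᶠ y in 𝓝 x, f y = f x → φ x ≤ φ y) {u : E} (hu : fderiv ℝ f x u = 0) :
    fderiv ℝ φ x u = 0 := by
  have hext : IsLocalExtrOn φ {y | f y = f x} x := Or.inl (eventually_nhdsWithin_iff.2 hmin)
  -- Lagrange multipliers: `a df + b dφ = 0` with `(a, b) ≠ 0`, and `df ≠ 0` rules out `b = 0`.
  obtain ⟨a, b, hab, h⟩ := hext.exists_multipliers_of_hasStrictFDerivAt_1d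
    (hf.hasStrictFDerivAt one_ne_zero) (hφ.hasStrictFDerivAt one_ne_zero)
  have hb : b ≠ 0 := by
    rintro rfl
    rw [zero_smul, add_zero, smul_eq_zero] at h
    exact h.elim (fun ha => hab (by rw [ha]; rfl)) hd
  have := congrArg (fun A : E →L[ℝ] ℝ => A u) h
  simp only [add_apply, smul_apply, hu, smul_zero, zero_add, zero_apply] at this
  exact (smul_eq_zero.1 this).resolve_left hb

theorem fderiv_fderiv_comm {f : E → ℝ} {x : E} (hf : ContDiffAt ℝ 2 f x) (v w : E) :
    fderiv ℝ (fderiv ℝ f) x v w = fderiv ℝ (fderiv ℝ f) x w v :=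
  (hf.isSymmSndFDerivAt (by simp)) v w

theorem fderiv_fderiv_fderiv_comm {f : E → ℝ} {x : E} (hf : ContDiffAt ℝ 3 f x) (u v w : E) :
    fderiv ℝ (fderiv ℝ (fderiv ℝ f)) x u v w = fderiv ℝ (fderiv ℝ (fderiv ℝ f)) x v u w := by
  have h : ContDiffAt ℝ 2 (fderiv ℝ f) x := hf.fderiv_right (by norm_num)
  rw [(h.isSymmSndFDerivAt (by simp)) u v]

theorem fderiv_fderiv_fderiv_comm_right {f : E → ℝ} {x : E} (hf : ContDiffAt ℝ 3 f x) (u v w : E) :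
    fderiv ℝ (fderiv ℝ (fderiv ℝ f)) x u v w = fderiv ℝ (fderiv ℝ (fderiv ℝ f)) x u w v := by
  have hd : DifferentiableAt ℝ (fderiv ℝ (fderiv ℝ f)) x :=
    ((hf.fderiv_right (m := 2) (by norm_num)).fderiv_right (m := 1) (by norm_num)).differentiableAt
      one_ne_zero
  have key : ∀ v w : E, HasFDerivAt (fun y => fderiv ℝ (fderiv ℝ f) y v w)
      (((fderiv ℝ (fderiv ℝ (fderiv ℝ f)) x).flip v).flip w) x := fun v w => by
    refine ((hd.hasFDerivAt.clm_apply (hasFDerivAt_const v x)).clm_apply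
      (hasFDerivAt_const w x)).congr_fderiv ?_
    ext u
    simp
  have hev : ∀ᶠ y in 𝓝 x, fderiv ℝ (fderiv ℝ f) y v w = fderiv ℝ (fderiv ℝ f) y w v := by
    filter_upwards [(hf.of_le (by norm_num : (2 : WithTop ℕ∞) ≤ 3)).eventually (by simp)] with y hy
    exact fderiv_fderiv_comm hy v w
  have h := (key v w).unique ((key w v).congr_of_eventuallyEq hev)
  exact congrArg (fun F : E →L[ℝ] ℝ => F u) h

/-- The null space of the Levi form of `ρ` at `x`, in flat coordinates. -/
def flatLeviNull (ρ : E → ℝ) (x : E) : Set E :=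
  {Z | covector10 (fderiv ℝ ρ x) Z = 0 ∧ ∀ V, covector10 (fderiv ℝ ρ x) V = 0 →
    hermitianPart (fderiv ℝ (fderiv ℝ ρ) x) Z V = 0}

/-! ### Null vectors of the Levi form and pseudoconvexity to third order. -/

section

variable {ρ : E → ℝ} {x : E}

/-- Subtracting `∂ρ(V) L` from `V` leaves a tangent vector, which pairs to zero with a null vector.
Hence only the transverse component of `V` counts. -/
theorem hermitianPart_of_mem_flatLeviNull {Z L : E} (hZ : Z ∈ flatLeviNull ρ x)
    (hL : covector10 (fderiv ℝ ρ x) L = 1) (V : E) :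
    hermitianPart (fderiv ℝ (fderiv ℝ ρ) x) Z V
      = conj (covector10 (fderiv ℝ ρ x) V) * hermitianPart (fderiv ℝ (fderiv ℝ ρ) x) Z L := by
  have h := hZ.2 (V - covector10 (fderiv ℝ ρ x) V • L)
    (by rw [covector10_sub, covector10_smul, hL]; ring)
  rwa [hermitianPart_sub_right, hermitianPart_smul_right, sub_eq_zero] at h

theorem flatLeviNull_add {Z W : E} (hZ : Z ∈ flatLeviNull ρ x) (hW : W ∈ flatLeviNull ρ x) :
    Z + W ∈ flatLeviNull ρ x :=
  ⟨by rw [covector10_add, hZ.1, hW.1, add_zero], fun V hV => by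
    rw [hermitianPart_add_left, hZ.2 V hV, hW.2 V hV, add_zero]⟩

theorem flatLeviNull_smul (c : ℂ) {Z : E} (hZ : Z ∈ flatLeviNull ρ x) :
    c • Z ∈ flatLeviNull ρ x :=
  ⟨by rw [covector10_smul, hZ.1, mul_zero], fun V hV => by
    rw [hermitianPart_smul_left, hZ.2 V hV, mul_zero]⟩

variable [CompleteSpace E]

/-- The correction of the derivative of the Levi form along `u` by the transverse directions. -/
def leviDeriv (ρ : E → ℝ) (x : E) (L u v w : E) : ℂ :=
  hermitianPart (fderiv ℝ (fderiv ℝ (fderiv ℝ ρ)) x u) v w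
    - hermitianPart (fderiv ℝ (fderiv ℝ ρ) x) L w * covector10 (fderiv ℝ (fderiv ℝ ρ) x u) v
    - conj (hermitianPart (fderiv ℝ (fderiv ℝ ρ) x) L v
      * covector10 (fderiv ℝ (fderiv ℝ ρ) x u) w)

/-- Along tangential directions, the derivative of the nonnegative Levi form vanishes on null
vectors. -/
theorem leviDeriv_self_eq_zero (hρ : ContDiffAt ℝ 3 ρ x) (hd : fderiv ℝ ρ x ≠ 0) {ℓ : E → E}
    (hℓ : ContDiffAt ℝ 1 ℓ x) (hℓ1 : ∀ᶠ y in 𝓝 x, covector10 (fderiv ℝ ρ y) (ℓ y) = 1)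
    (hpsc : ∀ᶠ y in 𝓝 x, ρ y = ρ x → ∀ v, covector10 (fderiv ℝ ρ y) v = 0 →
      0 ≤ (hermitianPart (fderiv ℝ (fderiv ℝ ρ) y) v v).re)
    {S u : E} (hS : S ∈ flatLeviNull ρ x) (hu : fderiv ℝ ρ x u = 0) :
    leviDeriv ρ x (ℓ x) u S S = 0 := by
  have h1 : ContDiffAt ℝ 2 (fderiv ℝ ρ) x := hρ.fderiv_right (by norm_num)
  have h2 : ContDiffAt ℝ 1 (fderiv ℝ (fderiv ℝ ρ)) x := h1.fderiv_right (by norm_num)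
  have hsymm : ∀ v w, fderiv ℝ (fderiv ℝ ρ) x v w = fderiv ℝ (fderiv ℝ ρ) x w v :=
    fderiv_fderiv_comm (hρ.of_le (by norm_num))
  have hsymm3 := fderiv_fderiv_fderiv_comm_right hρ u
  have hp : ContDiffAt ℝ 1 (fun y => covector10 (fderiv ℝ ρ y) S) x := by
    have h1' : ContDiffAt ℝ 1 (fderiv ℝ ρ) x := h1.of_le (by norm_num)
    have key : ∀ w : E, ContDiffAt ℝ 1 (fun y => (fderiv ℝ ρ y w : ℂ)) x := fun w =>
      Complex.ofRealCLM.contDiff.contDiffAt.comp x (h1'.clm_apply contDiffAt_const)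
    exact contDiffAt_const.mul ((key S).sub (contDiffAt_const.mul (key (Complex.I • S))))
  -- The extension of `S` by projection along `ℓ`: it is tangential to every nearby level set of
  -- `ρ`, and equals `S` at `x` because `S` is tangential there.
  set σ : E → E := fun y => S - covector10 (fderiv ℝ ρ y) S • ℓ y with hσ
  have hσd : ContDiffAt ℝ 1 σ x := contDiffAt_const.sub (hp.smul hℓ)
  have hσx : σ x = S := by simp [hσ, hS.1]
  have hσt : ∀ᶠ y in 𝓝 x, covector10 (fderiv ℝ ρ y) (σ y) = 0 := by
    filter_upwards [hℓ1] with y hy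
    rw [covector10_sub, covector10_smul, hy]; ring
  have hL := hℓ1.self_of_nhds
  have hF := contDiffAt_hermitianPart h2 hσd hσd
  have hFre : ContDiffAt ℝ 1
      (fun y => (hermitianPart (fderiv ℝ (fderiv ℝ ρ) y) (σ y) (σ y)).re) x :=
    Complex.reCLM.contDiff.contDiffAt.comp x hF
  have hF0 : hermitianPart (fderiv ℝ (fderiv ℝ ρ) x) (σ x) (σ x) = 0 := by
    rw [hσx]; exact hS.2 S hS.1
  -- Pseudoconvexity is available only on the level set through `x`, so the minimum is a constrained
  -- one and yields information only for `u` in the kernel of `dρ`.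
  have hzero := fderiv_apply_eq_zero_of_isMinOn_level (hρ.of_le (by norm_num)) hFre hd
    (by
      filter_upwards [hpsc, hσt] with y hy hy' hlev
      rw [hF0]
      exact hy hlev _ hy') hu
  have hre : (fderiv ℝ (fun y => hermitianPart (fderiv ℝ (fderiv ℝ ρ) y) (σ y) (σ y)) x u).re
      = 0 := by
    rw [← hzero]
    have := (Complex.reCLM.hasFDerivAt.comp x (hF.differentiableAt one_ne_zero).hasFDerivAt).fderiv
    exact (congrArg (fun F : E →L[ℝ] ℝ => F u) this).symm
  have hdσ := covector10_fderiv (h1.differentiableAt two_ne_zero) (hσd.differentiableAt one_ne_zero)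
    hσt u
  rw [fderiv_hermitianPart (h2.differentiableAt one_ne_zero) (hσd.differentiableAt one_ne_zero)
    (hσd.differentiableAt one_ne_zero), hσx] at hre
  rw [hσx] at hdσ
  have e1 := hermitianPart_of_mem_flatLeviNull hS hL (fderiv ℝ σ x u)
  have e2 := congrArg conj e1
  rw [hermitianPart_conj hsymm] at e2
  have e3 := hermitianPart_conj hsymm S (ℓ x)
  have e4 := hermitianPart_conj hsymm (ℓ x) S
  have e5 := hermitianPart_conj hsymm3 S S
  -- The terms with `dσ(u)` depend only on `∂ρ(dσ(u)) = -∂(D_u dρ)(S)`, since `S` is null. These are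
  -- the two corrections in `leviDeriv`.
  have hval : leviDeriv ρ x (ℓ x) u S S
      = hermitianPart (fderiv ℝ (fderiv ℝ (fderiv ℝ ρ)) x u) S S
        + hermitianPart (fderiv ℝ (fderiv ℝ ρ) x) (fderiv ℝ σ x u) S
        + hermitianPart (fderiv ℝ (fderiv ℝ ρ) x) S (fderiv ℝ σ x u) := by
    rw [e1, e2, leviDeriv, hdσ]
    simp only [map_mul, map_neg, Complex.conj_conj, e3, e4]
    ring
  -- The minimum controls only a real part; on the diagonal `leviDeriv` is real by Hermitian
  -- symmetry, so nothing else is left.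
  have him : conj (leviDeriv ρ x (ℓ x) u S S) = leviDeriv ρ x (ℓ x) u S S := by
    simp only [leviDeriv, map_sub, map_mul, Complex.conj_conj, e5]
    ring
  rw [← hval] at hre
  rw [Complex.conj_eq_iff_im] at him
  exact Complex.ext hre him

/-- `leviDeriv` is linear in `v` and conjugate-linear in `w`, and the null space is a complex
subspace, so vanishing on the diagonal polarizes. -/
theorem leviDeriv_eq_zero (hρ : ContDiffAt ℝ 3 ρ x) (hd : fderiv ℝ ρ x ≠ 0) {ℓ : E → E}
    (hℓ : ContDiffAt ℝ 1 ℓ x) (hℓ1 : ∀ᶠ y in 𝓝 x, covector10 (fderiv ℝ ρ y) (ℓ y) = 1)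
    (hpsc : ∀ᶠ y in 𝓝 x, ρ y = ρ x → ∀ v, covector10 (fderiv ℝ ρ y) v = 0 →
      0 ≤ (hermitianPart (fderiv ℝ (fderiv ℝ ρ) y) v v).re)
    {Z W u : E} (hZ : Z ∈ flatLeviNull ρ x) (hW : W ∈ flatLeviNull ρ x)
    (hu : fderiv ℝ ρ x u = 0) :
    leviDeriv ρ x (ℓ x) u Z W = 0 := by
  have key : ∀ {S : E}, S ∈ flatLeviNull ρ x → leviDeriv ρ x (ℓ x) u S S = 0 := fun hS =>
    leviDeriv_self_eq_zero hρ hd hℓ hℓ1 hpsc hS hu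
  have h1 := key hZ
  have h2 := key hW
  have h3 := key (flatLeviNull_add hZ hW)
  have h4 := key (flatLeviNull_add hZ (flatLeviNull_smul Complex.I hW))
  simp only [leviDeriv, hermitianPart_add_left, hermitianPart_add_right, hermitianPart_smul_left,
    hermitianPart_smul_right, covector10_add, covector10_smul, map_add, map_mul, Complex.conj_I,
    map_neg, neg_neg] at h1 h2 h3 h4 ⊢
  set X := hermitianPart (fderiv ℝ (fderiv ℝ (fderiv ℝ ρ)) x u)
  set H := hermitianPart (fderiv ℝ (fderiv ℝ ρ) x) (ℓ x)
  set c := covector10 (fderiv ℝ (fderiv ℝ ρ) x u)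
  -- Polarization of a sesquilinear form: `2 Q(Z, W) = Q(Z + W) + i Q(Z + iW) - (1 + i)(Q(Z) +
  -- Q(W))`.
  linear_combination (1 / 2 : ℂ) * h3 + (Complex.I / 2) * h4
    - (1 / 2 + Complex.I / 2) * h1 - (1 / 2 + Complex.I / 2) * h2
    + (1 / 2) * (X Z W - X W Z + Complex.I * X W W - H W * c Z - Complex.I * H W * c W + H Z * c W
      - conj (H Z) * conj (c W) - Complex.I * conj (H W) * conj (c W) + conj (H W) * conj (c Z))
      * Complex.I_sq

/-- Replacing one normal field by another does not change the `∂_Z`-derivative of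
`∂∂̄ρ(L, W̄)` when `Z` and `W` are null vectors. -/
theorem part10_fderiv_hermitianPart_normal_eq (hρ : ContDiffAt ℝ 3 ρ x) (hd : fderiv ℝ ρ x ≠ 0)
    {ℓ₀ ℓ₁ : E → E} (hℓ₀ : ContDiffAt ℝ 1 ℓ₀ x) (hℓ₁ : ContDiffAt ℝ 1 ℓ₁ x)
    (h0 : ∀ᶠ y in 𝓝 x, covector10 (fderiv ℝ ρ y) (ℓ₀ y) = 1)
    (h1 : ∀ᶠ y in 𝓝 x, covector10 (fderiv ℝ ρ y) (ℓ₁ y) = 1)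
    (hpsc : ∀ᶠ y in 𝓝 x, ρ y = ρ x → ∀ v, covector10 (fderiv ℝ ρ y) v = 0 →
      0 ≤ (hermitianPart (fderiv ℝ (fderiv ℝ ρ) y) v v).re)
    {Z W : E} (hZ : Z ∈ flatLeviNull ρ x) (hW : W ∈ flatLeviNull ρ x) :
    part10 (fderiv ℝ (fun y => hermitianPart (fderiv ℝ (fderiv ℝ ρ) y) (ℓ₁ y) W) x) Z
      = part10 (fderiv ℝ (fun y => hermitianPart (fderiv ℝ (fderiv ℝ ρ) y) (ℓ₀ y) W) x) Z := by
  have d1 : DifferentiableAt ℝ (fderiv ℝ ρ) x :=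
    (hρ.fderiv_right (m := 2) (by norm_num)).differentiableAt two_ne_zero
  have d2 : DifferentiableAt ℝ (fderiv ℝ (fderiv ℝ ρ)) x :=
    ((hρ.fderiv_right (m := 2) (by norm_num)).fderiv_right (m := 1) (by norm_num)).differentiableAt
      one_ne_zero
  have hsymm : ∀ v w, fderiv ℝ (fderiv ℝ ρ) x v w = fderiv ℝ (fderiv ℝ ρ) x w v :=
    fderiv_fderiv_comm (hρ.of_le (by norm_num))
  have t0 := h0.self_of_nhds
  have t1 := h1.self_of_nhds
  set T := ℓ₁ x - ℓ₀ x with hT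
  have hTt : covector10 (fderiv ℝ ρ x) T = 0 := by rw [covector10_sub, t0, t1, sub_self]
  have hTI : covector10 (fderiv ℝ ρ x) (Complex.I • T) = 0 := by rw [covector10_smul, hTt, mul_zero]
  have q1 := leviDeriv_eq_zero hρ hd hℓ₀ h0 hpsc hZ hW (apply_eq_zero_of_covector10_eq_zero hTt)
  have q2 := leviDeriv_eq_zero hρ hd hℓ₀ h0 hpsc hZ hW (apply_eq_zero_of_covector10_eq_zero hTI)
  have hWn : ∀ V, hermitianPart (fderiv ℝ (fderiv ℝ ρ) x) V W
      = covector10 (fderiv ℝ ρ x) V * hermitianPart (fderiv ℝ (fderiv ℝ ρ) x) (ℓ₀ x) W := by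
    intro V
    have := congrArg conj (hermitianPart_of_mem_flatLeviNull hW t0 V)
    rwa [hermitianPart_conj hsymm, map_mul, Complex.conj_conj, hermitianPart_conj hsymm] at this
  -- `H(T, W̄) = 0`, as `T` is tangential and `W` is null. This kills the conjugated correction of
  -- `leviDeriv` once `T` is restricted to its (1,0) part.
  have hWT := hermitianPart_eq (fderiv ℝ (fderiv ℝ ρ) x) T W
  rw [hWn, hTt, zero_mul] at hWT
  have hbil := bilinearPart_comm hsymm T Z
  simp only [bilinearPart] at hbil
  -- The derivatives of `ℓ₀` and `ℓ₁` disappear: paired with the null vector `W` they enter only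
  -- through `∂ρ`, which `covector10_fderiv` evaluates.
  have hdiff : ∀ u, fderiv ℝ (fun y => hermitianPart (fderiv ℝ (fderiv ℝ ρ) y) (ℓ₁ y) W) x u
      - fderiv ℝ (fun y => hermitianPart (fderiv ℝ (fderiv ℝ ρ) y) (ℓ₀ y) W) x u
      = hermitianPart (fderiv ℝ (fderiv ℝ (fderiv ℝ ρ)) x u) T W
        - hermitianPart (fderiv ℝ (fderiv ℝ ρ) x) (ℓ₀ x) W
          * covector10 (fderiv ℝ (fderiv ℝ ρ) x u) T := by
    intro u
    rw [fderiv_hermitianPart d2 (hℓ₁.differentiableAt one_ne_zero) (differentiableAt_const W),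
      fderiv_hermitianPart d2 (hℓ₀.differentiableAt one_ne_zero) (differentiableAt_const W),
      hWn (fderiv ℝ ℓ₁ x u), hWn (fderiv ℝ ℓ₀ x u),
      covector10_fderiv d1 (hℓ₁.differentiableAt one_ne_zero) h1,
      covector10_fderiv d1 (hℓ₀.differentiableAt one_ne_zero) h0, hT, hermitianPart_sub_left,
      covector10_sub]
    simp
    have hz : hermitianPart (fderiv ℝ (fderiv ℝ ρ) x) (ℓ₁ x) 0 = 0 := by simp [hermitianPart]
    have hz' : hermitianPart (fderiv ℝ (fderiv ℝ ρ) x) (ℓ₀ x) 0 = 0 := by simp [hermitianPart]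
    rw [hz, hz']
    ring
  have s3 := fderiv_fderiv_fderiv_comm hρ
  -- Both sides are, up to the same factor, the third derivative of `ρ` on the (1,0) vectors of `Z`
  -- and `T` and the (0,1) vector of `W`; `Z` and `T` may be exchanged.
  have hthird : hermitianPart (fderiv ℝ (fderiv ℝ (fderiv ℝ ρ)) x Z) T W
        - Complex.I * hermitianPart (fderiv ℝ (fderiv ℝ (fderiv ℝ ρ)) x (Complex.I • Z)) T W
      = hermitianPart (fderiv ℝ (fderiv ℝ (fderiv ℝ ρ)) x T) Z W
        - Complex.I * hermitianPart (fderiv ℝ (fderiv ℝ (fderiv ℝ ρ)) x (Complex.I • T)) Z W := by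
    simp only [hermitianPart, s3 Z, s3 (Complex.I • Z)]
    ring_nf
    simp only [Complex.I_sq]
    ring
  rw [← sub_eq_zero, part10_apply, part10_apply]
  simp only [leviDeriv, map_mul] at q1 q2
  have a1 := hdiff Z
  have a2 := hdiff (Complex.I • Z)
  -- The (1,0) part in `Z` of `hdiff`, with `Z` and `T` exchanged in the third-order term (`hthird`)
  -- and in the second-order term (`hbil`), is the (1,0) part in `T` of `leviDeriv`, which `q1` and
  -- `q2` make zero.
  linear_combination (1 / 2 : ℂ) * a1 - (Complex.I / 2) * a2 + (1 / 2 : ℂ) * hthird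
    + (1 / 2 : ℂ) * q1 - (Complex.I / 2) * q2
    + hermitianPart (fderiv ℝ (fderiv ℝ ρ) x) (ℓ₀ x) W * hbil
    - conj (hermitianPart (fderiv ℝ (fderiv ℝ ρ) x) (ℓ₀ x) Z) * hWT

end

end FlatCalculus

/-! ### Type components of forms evaluated on a pair `(Z_v, Z̄_w)`. -/

section Types

variable {T : Type*} [AddCommGroup T] [Module ℂ T] [TopologicalSpace T]

theorem form2_neg_left (b : T [⋀^Fin 2]→L[ℝ] ℂ) (x w : T) : b ![-x, w] = -b ![x, w] := by
  rw [← neg_one_smul ℝ x, form2_smul_left, neg_one_smul]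

theorem form2_neg_right (b : T [⋀^Fin 2]→L[ℝ] ℂ) (x w : T) : b ![w, -x] = -b ![w, x] := by
  rw [← neg_one_smul ℝ x, form2_smul_right, neg_one_smul]

theorem eval₁_holVec (a : T →L[ℝ] ℂ) (v : T) :
    eval₁ a (holVec v) = (1 / 2) * (a v - Complex.I * a (Complex.I • v)) := by
  simp only [eval₁, holVec, map_neg, map_smul, Complex.real_smul]
  push_cast
  ring

theorem eval₂_holVec_conjVec (b : T [⋀^Fin 2]→L[ℝ] ℂ) (v w : T) :
    eval₂ b (holVec v) (conjVec (holVec w)) = (1 / 4) * ((b ![v, w] + b ![Complex.I • v, Complex.I • w])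
      + Complex.I * (b ![v, Complex.I • w] - b ![Complex.I • v, w])) := by
  simp only [eval₂, holVec, conjVec, neg_neg, form2_neg_left, form2_smul_left, form2_smul_right,
    Complex.real_smul]
  push_cast
  ring

theorem eval₂_add (b c : T [⋀^Fin 2]→L[ℝ] ℂ) (X Y : Complexified T) :
    eval₂ (b + c) X Y = eval₂ b X Y + eval₂ c X Y := by
  have h : ∀ x y, (b + c) ![x, y] = b ![x, y] + c ![x, y] := fun _ _ => rfl
  simp only [eval₂, h]; ring

theorem eval₂_sub (b c : T [⋀^Fin 2]→L[ℝ] ℂ) (X Y : Complexified T) :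
    eval₂ (b - c) X Y = eval₂ b X Y - eval₂ c X Y := by
  have h : ∀ x y, (b - c) ![x, y] = b ![x, y] - c ![x, y] := fun _ _ => rfl
  simp only [eval₂, h]; ring

theorem eval₂_smul (k : ℂ) (b : T [⋀^Fin 2]→L[ℝ] ℂ) (X Y : Complexified T) :
    eval₂ (k • b) X Y = k * eval₂ b X Y := by
  have h : ∀ x y, (k • b) ![x, y] = k * b ![x, y] := fun _ _ => rfl
  simp only [eval₂, h]; ring

variable [ContinuousConstSMul ℂ T]

theorem compJ_apply (b : T [⋀^Fin 2]→L[ℝ] ℂ) (v w : T) :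
    b.compContinuousLinearMap J ![v, w] = b ![Complex.I • v, Complex.I • w] := by
  rw [ContinuousAlternatingMap.compContinuousLinearMap_apply]
  congr 1
  ext i; fin_cases i <;> rfl

theorem derivJ_apply [IsTopologicalAddGroup T] (b : T [⋀^Fin 2]→L[ℝ] ℂ) (v w : T) :
    derivJ b ![v, w] = b ![v, Complex.I • w] + b ![Complex.I • v, w] := by
  have h : b.compContinuousLinearMap (ContinuousLinearMap.id ℝ T + J) ![v, w]
      = b ![v + Complex.I • v, w + Complex.I • w] := by
    rw [ContinuousAlternatingMap.compContinuousLinearMap_apply]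
    congr 1
    ext i; fin_cases i <;> rfl
  have : derivJ b ![v, w] = b.compContinuousLinearMap (ContinuousLinearMap.id ℝ T + J) ![v, w]
      - b ![v, w] - b.compContinuousLinearMap J ![v, w] := rfl
  rw [this, h, compJ_apply]
  simp only [form2_add_left, form2_add_right]
  ring

theorem eval₂_part20 [IsTopologicalAddGroup T] (b : T [⋀^Fin 2]→L[ℝ] ℂ) (v w : T) :
    eval₂ (part20 b) (holVec v) (conjVec (holVec w)) = 0 := by
  have h : ∀ x y, part20 b ![x, y] = (1 / 4 : ℂ) * (b ![x, y] - b.compContinuousLinearMap J ![x, y]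
      - Complex.I * derivJ b ![x, y]) := fun _ _ => rfl
  rw [eval₂_holVec_conjVec]
  simp only [h, compJ_apply, derivJ_apply, I_smul_I_smul, form2_neg_left, form2_neg_right, neg_neg]
  ring

theorem eval₂_part02 [IsTopologicalAddGroup T] (b : T [⋀^Fin 2]→L[ℝ] ℂ) (v w : T) :
    eval₂ (part02 b) (holVec v) (conjVec (holVec w)) = 0 := by
  have h : ∀ x y, part02 b ![x, y] = (1 / 4 : ℂ) * (b ![x, y] - b.compContinuousLinearMap J ![x, y]
      + Complex.I * derivJ b ![x, y]) := fun _ _ => rfl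
  rw [eval₂_holVec_conjVec]
  simp only [h, compJ_apply, derivJ_apply, I_smul_I_smul, form2_neg_left, form2_neg_right, neg_neg]
  ring

theorem eval₂_part11 (b : T [⋀^Fin 2]→L[ℝ] ℂ) (v w : T) :
    eval₂ (part11 b) (holVec v) (conjVec (holVec w)) = eval₂ b (holVec v) (conjVec (holVec w)) := by
  have h : ∀ x y, part11 b ![x, y] = (1 / 2 : ℂ) * (b ![x, y] + b.compContinuousLinearMap J ![x, y]) :=
    fun _ _ => rfl
  rw [eval₂_holVec_conjVec, eval₂_holVec_conjVec]
  simp only [h, compJ_apply, I_smul_I_smul, form2_neg_left, form2_neg_right, neg_neg]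
  ring

/-- Needed because `del₁` splits its argument again, although `∂̄r` is already of type (0,1). -/
theorem part01_part01 (a : T →L[ℝ] ℂ) : part01 (part01 a) = part01 a := by
  ext v
  simp only [part01_apply, I_smul_I_smul, map_neg]
  linear_combination (-(1 / 4 : ℂ)) * a v * Complex.I_sq

theorem part01_I_smul (a : T →L[ℝ] ℂ) (v : T) :
    part01 a (Complex.I • v) = -Complex.I * part01 a v := by
  simp only [part01_apply, I_smul_I_smul, map_neg]
  linear_combination ((1 / 2 : ℂ)) * a (Complex.I • v) * Complex.I_sq

theorem part10_I_smul (a : T →L[ℝ] ℂ) (v : T) :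
    part10 a (Complex.I • v) = Complex.I * part10 a v := by
  simp only [part10_apply, I_smul_I_smul, map_neg]
  linear_combination ((1 / 2 : ℂ)) * a (Complex.I • v) * Complex.I_sq

end Types

/-! ### The exterior derivative in a vector space. -/

section FlatForms

variable {E : Type*} [NormedAddCommGroup E] [NormedSpace ℂ E]

/-- The exterior derivative of the `1`-form on the vector space `E` with coefficients `a`. -/
def flatD (a : E → E →L[ℝ] ℂ) (x : E) : E [⋀^Fin 2]→L[ℝ] ℂ :=
  extDeriv (fun y => ContinuousAlternatingMap.ofSubsingleton ℝ E ℂ (0 : Fin 1) (a y)) x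

theorem differentiableAt_ofSubsingleton {a : E → E →L[ℝ] ℂ} {x : E} (ha : DifferentiableAt ℝ a x) :
    DifferentiableAt ℝ
      (fun y => ContinuousAlternatingMap.ofSubsingleton ℝ E ℂ (0 : Fin 1) (a y)) x :=
  (ContinuousAlternatingMap.ofSubsingletonLIE (𝕜 := ℝ) (E := E) (F := ℂ)
    (0 : Fin 1)).toContinuousLinearEquiv.differentiableAt.comp x ha

theorem flatD_apply {a : E → E →L[ℝ] ℂ} {x : E} (ha : DifferentiableAt ℝ a x) (v w : E) :
    flatD a x ![v, w] = fderiv ℝ a x v w - fderiv ℝ a x w v := by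
  have h : ∀ v w, fderiv ℝ (fun y => a y w) x v = fderiv ℝ a x v w := fun v w => by
    rw [fderiv_clm_apply ha (differentiableAt_const w)]
    simp
  rw [flatD, extDeriv_apply (differentiableAt_ofSubsingleton ha), Fin.sum_univ_two, ← h, ← h]
  simp [sub_eq_add_neg, Fin.removeNth]

theorem fderiv_apply_const {a : E → E →L[ℝ] ℂ} {x : E} (ha : DifferentiableAt ℝ a x) (v w : E) :
    fderiv ℝ (fun y => a y w) x v = fderiv ℝ a x v w := by
  rw [fderiv_clm_apply ha (differentiableAt_const w)]
  simp

/-- For a `(0,1)`-form `a`, `da(Z_v, Z̄_w) = ∂_v (a(Z̄_w))`. -/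
theorem eval₂_flatD_of_antilinear {a : E → E →L[ℝ] ℂ} {x : E} (ha : DifferentiableAt ℝ a x)
    (h01 : ∀ᶠ y in 𝓝 x, ∀ v, a y (Complex.I • v) = -Complex.I * a y v) (v w : E) :
    eval₂ (flatD a x) (holVec v) (conjVec (holVec w)) = part10 (fderiv ℝ (fun y => a y w) x) v := by
  have h : ∀ u z, fderiv ℝ a x u (Complex.I • z) = -Complex.I * fderiv ℝ a x u z := fun u z => by
    have hz : DifferentiableAt ℝ (fun y => a y z) x := ha.clm_apply (differentiableAt_const z)
    have e : (fun y => a y (Complex.I • z)) =ᶠ[𝓝 x] fun y => -Complex.I * a y z :=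
      h01.mono fun y hy => hy z
    rw [← fderiv_apply_const ha, e.fderiv_eq, fderiv_const_mul hz, ← fderiv_apply_const ha]
    rfl
  rw [eval₂_holVec_conjVec, part10_apply]
  simp only [flatD_apply ha, fderiv_apply_const ha, h]
  linear_combination (-(1 / 4 : ℂ)) * (fderiv ℝ a x v w
    + fderiv ℝ a x w v) * Complex.I_sq

/-- For a `(1,0)`-form `a`, `da(Z_v, Z̄_w) = -∂̄_w (a(Z_v))`. -/
theorem eval₂_flatD_of_linear {a : E → E →L[ℝ] ℂ} {x : E} (ha : DifferentiableAt ℝ a x)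
    (h10 : ∀ᶠ y in 𝓝 x, ∀ v, a y (Complex.I • v) = Complex.I * a y v) (v w : E) :
    eval₂ (flatD a x) (holVec v) (conjVec (holVec w)) = -part01 (fderiv ℝ (fun y => a y v) x) w := by
  have h : ∀ u z, fderiv ℝ a x u (Complex.I • z) = Complex.I * fderiv ℝ a x u z := fun u z => by
    have hz : DifferentiableAt ℝ (fun y => a y z) x := ha.clm_apply (differentiableAt_const z)
    have e : (fun y => a y (Complex.I • z)) =ᶠ[𝓝 x] fun y => Complex.I * a y z :=
      h10.mono fun y hy => hy z
    rw [← fderiv_apply_const ha, e.fderiv_eq, fderiv_const_mul hz, ← fderiv_apply_const ha]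
    rfl
  rw [eval₂_holVec_conjVec, part01_apply]
  simp only [flatD_apply ha, fderiv_apply_const ha, h]
  linear_combination (1 / 4 : ℂ) * (fderiv ℝ a x v w
    + fderiv ℝ a x w v) * Complex.I_sq

theorem flatD_pullback {a : E → E →L[ℝ] ℂ} {τ : E → E} {x : E} (ha : DifferentiableAt ℝ a (τ x))
    (hτ : ContDiffAt ℝ 2 τ x) :
    flatD (fun y => (a (τ y)).comp (fderiv ℝ τ y)) x
      = (flatD a (τ x)).compContinuousLinearMap (fderiv ℝ τ x) := by
  rw [flatD, flatD, ← extDeriv_pullback (differentiableAt_ofSubsingleton ha) hτ (by simp)]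
  rfl

end FlatForms

/-! ### Change of charts for tangent vectors, `1`-forms and their differentials. -/

section Charts

variable {E : Type*} [NormedAddCommGroup E]
variable {M : Type*} [TopologicalSpace M] [ChartedSpace E M]

/-- The change of coordinates from the preferred chart at `p` to the preferred chart at `q`. -/
def transition (p q : M) : E → E := chartAt E q ∘ (chartAt E p).symm

theorem transition_comp_eventuallyEq {p q s : M} {x : E} (hx : x ∈ (chartAt E p).target)
    (hq : (chartAt E p).symm x ∈ (chartAt E q).source) :
    transition p s =ᶠ[𝓝 x] transition q s ∘ transition p q := by
  have h := ((chartAt E p).symm.continuousAt hx).eventually ((chartAt E q).open_source.mem_nhds hq)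
  filter_upwards [h] with y hy
  simp only [transition, Function.comp_apply]
  rw [(chartAt E q).left_inv hy]

theorem transition_self_eventuallyEq {p : M} {x : E} (hx : x ∈ (chartAt E p).target) :
    transition p p =ᶠ[𝓝 x] id := by
  filter_upwards [(chartAt E p).open_target.mem_nhds hx] with y hy
  exact (chartAt E p).right_inv hy

variable [NormedSpace ℂ E] [IsManifold 𝓘(ℂ, E) ω M]

theorem contDiffAt_transition {p q : M} {x : E} (hx : x ∈ (chartAt E p).target)
    (hq : (chartAt E p).symm x ∈ (chartAt E q).source) :
    ContDiffAt ℂ ω (transition p q) x := by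
  have h := contDiffWithinAt_ext_coord_change (I := 𝓘(ℂ, E)) (n := ω) q p (y := x)
    (by simpa [mfld_simps] using ⟨hx, hq⟩)
  simpa [contDiffWithinAt_univ, mfld_simps, transition] using h

theorem contDiffAt_transition_real {p q : M} {x : E} (hx : x ∈ (chartAt E p).target)
    (hq : (chartAt E p).symm x ∈ (chartAt E q).source) :
    ContDiffAt ℝ ω (transition p q) x :=
  (contDiffAt_transition hx hq).restrict_scalars ℝ

theorem fderiv_real_transition {p q : M} {x : E} (hx : x ∈ (chartAt E p).target)
    (hq : (chartAt E p).symm x ∈ (chartAt E q).source) :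
    fderiv ℝ (transition p q) x = (fderiv ℂ (transition p q) x).restrictScalars ℝ :=
  ((contDiffAt_transition hx hq).differentiableAt (by simp)).fderiv_restrictScalars ℝ

/-- The tangent space at `p` is a copy of `E` that is identified through the preferred chart at `p`,
so that chart has identity derivative there. -/
theorem chartDeriv_self (p : M) : chartDeriv p p = ContinuousLinearMap.id ℝ E := by
  have h : mfderiv 𝓘(ℂ, E) 𝓘(ℂ, E) (chartAt E p) p = ContinuousLinearMap.id ℂ E := by
    have hm : MDifferentiableAt 𝓘(ℂ, E) 𝓘(ℂ, E) (chartAt E p) p :=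
      mdifferentiableAt_atlas (chart_mem_atlas E p) (mem_chart_source E p)
    have e := (transition_self_eventuallyEq (E := E) (mem_chart_target E p)).fderiv_eq (𝕜 := ℂ)
    rw [fderiv_id] at e
    rw [hm.mfderiv, ← e]
    simp [writtenInExtChartAt, extChartAt]
    rfl
  ext v
  exact congrArg (fun F : E →L[ℂ] E => F v) h

/-- The target is the tangent space at the image point, read in the preferred chart of that point;
hence the derivative of a chart transition. The target chart thus varies with `x`, which is why the
transitions below are needed. -/
theorem chartSymmDeriv_eq {p : M} {x : E} (hx : x ∈ (chartAt E p).target) :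
    chartSymmDeriv p x = fderiv ℂ (transition p ((chartAt E p).symm x)) x := by
  have hm : MDifferentiableAt 𝓘(ℂ, E) 𝓘(ℂ, E) (chartAt E p).symm x :=
    mdifferentiableAt_atlas_symm (chart_mem_atlas E p) hx
  rw [chartSymmDeriv, hm.mfderiv]
  simp [writtenInExtChartAt, extChartAt]
  rfl


theorem chartSymmDeriv_chartAt (p : M) :
    chartSymmDeriv p (chartAt E p p) = ContinuousLinearMap.id ℂ E := by
  rw [chartSymmDeriv_eq (mem_chart_target E p)]
  rw [(chartAt E p).left_inv (mem_chart_source E p),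
    (transition_self_eventuallyEq (mem_chart_target E p)).fderiv_eq, fderiv_id]

theorem chartSymmDeriv_comp {p q : M} {x : E} (hx : x ∈ (chartAt E p).target)
    (hq : (chartAt E p).symm x ∈ (chartAt E q).source) :
    (chartSymmDeriv p x : E →L[ℂ] E)
      = (chartSymmDeriv q (transition p q x) : E →L[ℂ] E).comp (fderiv ℂ (transition p q) x) := by
  have hx' : transition p q x ∈ (chartAt E q).target := (chartAt E q).map_source hq
  have hs : (chartAt E q).symm (transition p q x) = (chartAt E p).symm x :=
    (chartAt E q).left_inv hq
  rw [chartSymmDeriv_eq hx, chartSymmDeriv_eq hx', hs]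
  rw [(transition_comp_eventuallyEq hx hq).fderiv_eq, fderiv_comp]
  · rfl
  · refine (contDiffAt_transition hx' ?_).differentiableAt (by simp)
    rw [hs]; exact mem_chart_source E _
  · exact (contDiffAt_transition hx hq).differentiableAt (by simp)

/-- The derivative of an inverse chart is bijective. -/
theorem exists_chartSymmDeriv_inverse {p : M} {x : E} (hx : x ∈ (chartAt E p).target) :
    ∃ A' : E →L[ℂ] E, (∀ v : E, A' (chartSymmDeriv p x v) = v) ∧
      ∀ v : E, chartSymmDeriv p x (A' v) = v := by
  set q := (chartAt E p).symm x with hq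
  have hqs : q ∈ (chartAt E q).source := mem_chart_source E q
  have hqp : q ∈ (chartAt E p).source := (chartAt E p).map_target hx
  have hx' : transition p q x ∈ (chartAt E q).target := (chartAt E q).map_source hqs
  have hs : (chartAt E q).symm (transition p q x) = q := (chartAt E q).left_inv hqs
  have hxx : transition q p (transition p q x) = x := by
    rw [transition, Function.comp_apply, hs, hq, (chartAt E p).right_inv hx]
  have d1 : DifferentiableAt ℂ (transition p q) x :=
    (contDiffAt_transition hx hqs).differentiableAt (by simp)
  have d2 : DifferentiableAt ℂ (transition q p) (transition p q x) :=
    (contDiffAt_transition hx' (by rw [hs]; exact hqp)).differentiableAt (by simp)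
  have d3 : DifferentiableAt ℂ (transition p q) (transition q p (transition p q x)) := by
    rwa [hxx]
  -- The two transitions are mutually inverse near the points concerned; differentiating both
  -- composites gives a left and a right inverse.
  have e1 := (transition_comp_eventuallyEq (s := p) hx hqs).fderiv_eq (𝕜 := ℂ)
  rw [(transition_self_eventuallyEq hx).fderiv_eq, fderiv_id, fderiv_comp _ d2 d1] at e1
  have e2 := (transition_comp_eventuallyEq (s := q) hx' (q := p) (by rw [hs]; exact hqp)).fderiv_eq
    (𝕜 := ℂ)
  rw [(transition_self_eventuallyEq hx').fderiv_eq, fderiv_id, fderiv_comp _ d3 d2, hxx] at e2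
  rw [chartSymmDeriv_eq hx]
  exact ⟨fderiv ℂ (transition q p) (transition p q x),
    fun v => (congrArg (fun F : E →L[ℂ] E => F v) e1).symm,
    fun v => (congrArg (fun F : E →L[ℂ] E => F v) e2).symm⟩

/-- A `1`-form in two charts. -/
theorem inChart_eq_pullback (a : Form1 E M) {p q : M} {x : E} (hx : x ∈ (chartAt E p).target)
    (hq : (chartAt E p).symm x ∈ (chartAt E q).source) :
    inChart a p x = (inChart a q (transition p q x)).comp (fderiv ℝ (transition p q) x) := by
  have hs : (chartAt E q).symm (transition p q x) = (chartAt E p).symm x :=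
    (chartAt E q).left_inv hq
  let a' : M → E →L[ℝ] ℂ := a
  have h1 : inChart a p x = (a' ((chartAt E p).symm x)).comp
    ((chartSymmDeriv p x : E →L[ℂ] E).restrictScalars ℝ) := rfl
  have h2 : inChart a q (transition p q x) = (a' ((chartAt E q).symm (transition p q x))).comp
    ((chartSymmDeriv q (transition p q x) : E →L[ℂ] E).restrictScalars ℝ) := rfl
  rw [h1, h2, hs, chartSymmDeriv_comp hx hq, fderiv_real_transition hx hq]
  rfl

theorem d₀_eq (f : M → ℝ) (q : M) :
    (d₀ f q : E →L[ℝ] ℂ)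
      = Complex.ofRealCLM.comp (fderiv ℝ (f ∘ (chartAt E q).symm) (chartAt E q q)) := by
  have h : (d₀ f q : E →L[ℝ] ℂ) = (Complex.ofRealCLM.comp
    (fderiv ℝ (f ∘ (chartAt E q).symm) (chartAt E q q))).comp (chartDeriv q q) := rfl
  rw [h, chartDeriv_self]
  rfl

theorem d₁_eq (a : Form1 E M) (q : M) :
    (d₁ a q : E [⋀^Fin 2]→L[ℝ] ℂ) = flatD (inChart a q) (chartAt E q q) := by
  have h : (d₁ a q : E [⋀^Fin 2]→L[ℝ] ℂ) = (flatD (inChart a q)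
    (chartAt E q q)).compContinuousLinearMap (chartDeriv q q) := rfl
  rw [h, chartDeriv_self]
  rfl

/-- The differential of a function in a chart. -/
theorem inChart_d₀ (f : M → ℝ) {p : M} {x : E} (hx : x ∈ (chartAt E p).target)
    (hf : DifferentiableAt ℝ (f ∘ (chartAt E ((chartAt E p).symm x)).symm)
      (chartAt E ((chartAt E p).symm x) ((chartAt E p).symm x))) :
    inChart (d₀ f) p x = Complex.ofRealCLM.comp (fderiv ℝ (f ∘ (chartAt E p).symm) x) := by
  set q := (chartAt E p).symm x with hq
  have hqs : q ∈ (chartAt E q).source := mem_chart_source E q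
  have h1 : inChart (d₀ f) p x = (d₀ f q : E →L[ℝ] ℂ).comp
    ((chartSymmDeriv p x : E →L[ℂ] E).restrictScalars ℝ) := rfl
  have e : f ∘ (chartAt E p).symm =ᶠ[𝓝 x] (f ∘ (chartAt E q).symm) ∘ transition p q := by
    filter_upwards [((chartAt E p).symm.continuousAt hx).eventually
      ((chartAt E q).open_source.mem_nhds hqs)] with y hy
    simp only [transition, Function.comp_apply]
    rw [(chartAt E q).left_inv hy]
  rw [h1, d₀_eq, chartSymmDeriv_eq hx, e.fderiv_eq, fderiv_comp _ (by exact hf)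
    ((contDiffAt_transition_real hx hqs).differentiableAt (by simp)),
    fderiv_real_transition hx hqs]
  rfl

/-- The exterior derivative of a `1`-form in a chart. -/
theorem d₁_inChart (a : Form1 E M) {p : M} {x : E} (hx : x ∈ (chartAt E p).target)
    (ha : DifferentiableAt ℝ (inChart a ((chartAt E p).symm x))
      (chartAt E ((chartAt E p).symm x) ((chartAt E p).symm x))) :
    (d₁ a ((chartAt E p).symm x)).compContinuousLinearMap
      ((chartSymmDeriv p x : E →L[ℂ] E).restrictScalars ℝ) = flatD (inChart a p) x := by
  set q := (chartAt E p).symm x with hq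
  have hqs : q ∈ (chartAt E q).source := mem_chart_source E q
  have e : inChart a p =ᶠ[𝓝 x]
      fun y => (inChart a q (transition p q y)).comp (fderiv ℝ (transition p q) y) := by
    filter_upwards [((chartAt E p).symm.continuousAt hx).eventually
      ((chartAt E q).open_source.mem_nhds hqs), (chartAt E p).open_target.mem_nhds hx] with y hy hy'
    exact inChart_eq_pullback a hy' hy
  have h2 : flatD (inChart a p) x = flatD
      (fun y => (inChart a q (transition p q y)).comp (fderiv ℝ (transition p q) y)) x := by
    rw [flatD, flatD]
    refine Filter.EventuallyEq.extDeriv_eq ?_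
    filter_upwards [e] with y hy
    rw [hy]
  -- Exterior differentiation commutes with pull-back along the transition, whose derivative is
  -- `chartSymmDeriv`.
  rw [h2, flatD_pullback (by exact ha) ((contDiffAt_transition_real hx hqs).of_le le_top),
    fderiv_real_transition hx hqs, chartSymmDeriv_eq hx]
  have h1 := d₁_eq a q
  exact congrArg (fun b : E [⋀^Fin 2]→L[ℝ] ℂ => b.compContinuousLinearMap
    ((fderiv ℂ (transition p q) x).restrictScalars ℝ)) h1

end Charts

/-! ### The differential and the complex Hessian of a function in a chart. -/

section Hessian

variable {E : Type*} [NormedAddCommGroup E] [NormedSpace ℂ E]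
variable {M : Type*} [TopologicalSpace M] [ChartedSpace E M]

theorem eval₁_part10 {T : Type*} [AddCommGroup T] [Module ℂ T] [TopologicalSpace T]
    [ContinuousConstSMul ℂ T] (a : T →L[ℝ] ℂ) (v : T) :
    eval₁ (part10 a) (holVec v) = part10 a v := by
  rw [eval₁_holVec, part10_I_smul]
  linear_combination (-(1 / 2 : ℂ)) * part10 a v * Complex.I_sq

theorem eval₂_comp_holVec {T : Type*} [AddCommGroup T] [Module ℂ T] [TopologicalSpace T]
    (b : T [⋀^Fin 2]→L[ℝ] ℂ) (A : E →L[ℂ] T) (B : E →L[ℝ] T) (hAB : ∀ v, B v = A v) (v w : E) :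
    eval₂ (b.compContinuousLinearMap B) (holVec v) (conjVec (holVec w))
      = eval₂ b (holVec (A v)) (conjVec (holVec (A w))) := by
  have h : ∀ x y, b.compContinuousLinearMap B ![x, y] = b ![A x, A y] := fun x y => by
    rw [ContinuousAlternatingMap.compContinuousLinearMap_apply]
    congr 1
    ext i; fin_cases i <;> exact hAB _
  rw [eval₂_holVec_conjVec, eval₂_holVec_conjVec]
  simp only [h, map_smul]

variable [IsManifold 𝓘(ℂ, E) ω M]

/-- Smoothness on `M` speaks of the preferred chart at each point; a real-analytic transition
carries it to the fixed chart at `p`. -/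
theorem contDiffAt_comp_chart_symm {k : WithTop ℕ∞} {U : Set M} {r : M → ℝ} (hU : IsOpen U)
    (hr : ContMDiffOn 𝓘(ℝ, E) 𝓘(ℝ, ℝ) k r U) {p : M} {x : E} (hx : x ∈ (chartAt E p).target)
    (hxU : (chartAt E p).symm x ∈ U) : ContDiffAt ℝ k (r ∘ (chartAt E p).symm) x := by
  set q := (chartAt E p).symm x with hq
  have hqs : q ∈ (chartAt E q).source := mem_chart_source E q
  have h1 : ContDiffAt ℝ k (r ∘ (chartAt E q).symm) (chartAt E q q) := by
    have h := (contMDiffAt_iff.1 ((hr q hxU).contMDiffAt (hU.mem_nhds hxU))).2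
    simp only [contDiffWithinAt_univ, mfld_simps] at h
    exact h
  have e : r ∘ (chartAt E p).symm =ᶠ[𝓝 x] (r ∘ (chartAt E q).symm) ∘ transition p q := by
    filter_upwards [((chartAt E p).symm.continuousAt hx).eventually
      ((chartAt E q).open_source.mem_nhds hqs)] with y hy
    simp only [transition, Function.comp_apply]
    rw [(chartAt E q).left_inv hy]
  exact (ContDiffAt.comp x (by exact h1)
    ((contDiffAt_transition_real hx hqs).of_le le_top)).congr_of_eventuallyEq e

variable {U : Set M} {r : M → ℝ}

theorem inChart_d₀_of_contMDiffOn {k : WithTop ℕ∞} (hk : k ≠ 0) (hU : IsOpen U)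
    (hr : ContMDiffOn 𝓘(ℝ, E) 𝓘(ℝ, ℝ) k r U) {p : M} {x : E} (hx : x ∈ (chartAt E p).target)
    (hxU : (chartAt E p).symm x ∈ U) :
    inChart (d₀ r) p x = Complex.ofRealCLM.comp (fderiv ℝ (r ∘ (chartAt E p).symm) x) := by
  refine inChart_d₀ r hx ((contDiffAt_comp_chart_symm hU hr (mem_chart_target E _) ?_).differentiableAt hk)
  rwa [(chartAt E _).left_inv (mem_chart_source E _)]

/-- The `(1,0)` part of `dr` in a chart. -/
theorem eval₁_del₀_chart {k : WithTop ℕ∞} (hk : k ≠ 0) (hU : IsOpen U)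
    (hr : ContMDiffOn 𝓘(ℝ, E) 𝓘(ℝ, ℝ) k r U) {p : M} {x : E} (hx : x ∈ (chartAt E p).target)
    (hxU : (chartAt E p).symm x ∈ U) (v : E) :
    eval₁ (del₀ r ((chartAt E p).symm x)) (holVec (chartSymmDeriv p x v))
      = covector10 (fderiv ℝ (r ∘ (chartAt E p).symm) x) v := by
  have h : ∀ v : E, d₀ r ((chartAt E p).symm x) (chartSymmDeriv p x v)
      = fderiv ℝ (r ∘ (chartAt E p).symm) x v := fun v =>
    congrArg (fun F : E →L[ℝ] ℂ => F v) (inChart_d₀_of_contMDiffOn hk hU hr hx hxU)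
  rw [del₀, eval₁_part10, part10_apply, ← map_smul, h, h, covector10]

theorem inChart_delbar₀ {k : WithTop ℕ∞} (hk : k ≠ 0) (hU : IsOpen U)
    (hr : ContMDiffOn 𝓘(ℝ, E) 𝓘(ℝ, ℝ) k r U) {p : M} {x : E} (hx : x ∈ (chartAt E p).target)
    (hxU : (chartAt E p).symm x ∈ U) :
    inChart (delbar₀ r) p x
      = part01 (Complex.ofRealCLM.comp (fderiv ℝ (r ∘ (chartAt E p).symm) x)) := by
  rw [← inChart_d₀_of_contMDiffOn hk hU hr hx hxU]
  ext v
  have h : inChart (delbar₀ r) p x v = part01 (d₀ r ((chartAt E p).symm x)) (chartSymmDeriv p x v) :=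
    rfl
  rw [h, part01_apply, part01_apply, ← map_smul]
  rfl

theorem differentiableAt_part01_fderiv {ρ : E → ℝ} {x : E} (hρ : ContDiffAt ℝ 2 ρ x) :
    DifferentiableAt ℝ (fun y => part01 (Complex.ofRealCLM.comp (fderiv ℝ ρ y))) x := by
  have h : DifferentiableAt ℝ (fderiv ℝ ρ) x :=
    (hρ.fderiv_right (m := 1) (by norm_num)).differentiableAt one_ne_zero
  have h1 : DifferentiableAt ℝ (fun y => Complex.ofRealCLM.comp (fderiv ℝ ρ y)) x :=
    (differentiableAt_const _).clm_comp h
  exact (h1.add ((h1.clm_comp (differentiableAt_const J)).const_smul Complex.I)).const_smul (1 / 2 : ℂ)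

/-- On a pair `(Z_v, Z̄_w)` the form `d∂̄ρ` differentiates the antilinear covector `∂̄ρ` along
`Z_v`, which gives the mixed second derivative. -/
theorem eval₂_flatD_part01_fderiv {ρ : E → ℝ} {x : E} (hρ : ContDiffAt ℝ 2 ρ x) (v w : E) :
    eval₂ (flatD (fun y => part01 (Complex.ofRealCLM.comp (fderiv ℝ ρ y))) x) (holVec v)
      (conjVec (holVec w)) = hermitianPart (fderiv ℝ (fderiv ℝ ρ) x) v w := by
  have hd := differentiableAt_part01_fderiv hρ
  have h : HasFDerivAt (fderiv ℝ ρ) (fderiv ℝ (fderiv ℝ ρ) x) x :=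
    ((hρ.fderiv_right (m := 1) (by norm_num)).differentiableAt one_ne_zero).hasFDerivAt
  rw [eval₂_flatD_of_antilinear hd (.of_forall fun y v => part01_I_smul _ v)]
  have key : ∀ u, fderiv ℝ (fun y => part01 (Complex.ofRealCLM.comp (fderiv ℝ ρ y)) w) x u
      = part01 (Complex.ofRealCLM.comp (fderiv ℝ (fderiv ℝ ρ) x u)) w := by
    intro u
    have h1 : ∀ z : E, HasFDerivAt (fun y => (fderiv ℝ ρ y z : ℂ))
        (Complex.ofRealCLM.comp ((fderiv ℝ (fderiv ℝ ρ) x).flip z)) x := fun z => by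
      refine Complex.ofRealCLM.hasFDerivAt.comp x
        ((h.clm_apply (hasFDerivAt_const z x)).congr_fderiv ?_)
      ext u
      simp
    have h2 := ((h1 w).add ((h1 (Complex.I • w)).const_mul Complex.I)).const_mul (1 / 2)
    exact congrArg (fun F : E →L[ℝ] ℂ => F u) h2.fderiv
  rw [part10_apply, key, key, part01_apply, part01_apply]
  simp only [ContinuousLinearMap.comp_apply, Complex.ofRealCLM_apply, hermitianPart]
  linear_combination (-(1 / 4 : ℂ)) *
    (fderiv ℝ (fderiv ℝ ρ) x (Complex.I • v) (Complex.I • w) : ℂ) * Complex.I_sq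

/-- The complex Hessian in a chart. -/
theorem eval₂_ddbar_chart {k : WithTop ℕ∞} (hk : 2 ≤ k) (hU : IsOpen U)
    (hr : ContMDiffOn 𝓘(ℝ, E) 𝓘(ℝ, ℝ) k r U) {p : M} {x : E} (hx : x ∈ (chartAt E p).target)
    (hxU : (chartAt E p).symm x ∈ U) (v w : E) :
    eval₂ (ddbar r ((chartAt E p).symm x)) (holVec (chartSymmDeriv p x v))
        (conjVec (holVec (chartSymmDeriv p x w)))
      = hermitianPart (fderiv ℝ (fderiv ℝ (r ∘ (chartAt E p).symm)) x) v w := by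
  have hk0 : k ≠ 0 := fun h => by simp [h] at hk
  have hev : ∀ (p : M) (x : E), x ∈ (chartAt E p).target → (chartAt E p).symm x ∈ U →
      inChart (delbar₀ r) p =ᶠ[𝓝 x]
        fun y => part01 (Complex.ofRealCLM.comp (fderiv ℝ (r ∘ (chartAt E p).symm) y)) := by
    intro p x hx hxU
    filter_upwards [(chartAt E p).open_target.mem_nhds hx,
      ((chartAt E p).symm.continuousAt hx).eventually (hU.mem_nhds hxU)] with y hy hyU
    exact inChart_delbar₀ hk0 hU hr hy hyU
  have hC : ∀ (p : M) (x : E), x ∈ (chartAt E p).target → (chartAt E p).symm x ∈ U →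
      ContDiffAt ℝ 2 (r ∘ (chartAt E p).symm) x := fun p x hx hxU =>
    (contDiffAt_comp_chart_symm hU hr hx hxU).of_le hk
  set q := (chartAt E p).symm x with hq
  have hqU : (chartAt E q).symm (chartAt E q q) ∈ U := by
    rwa [(chartAt E q).left_inv (mem_chart_source E q)]
  have hdiff : DifferentiableAt ℝ (inChart (delbar₀ r) q) (chartAt E q q) :=
    (differentiableAt_part01_fderiv (hC q _ (mem_chart_target E q) hqU)).congr_of_eventuallyEq
      (hev q _ (mem_chart_target E q) hqU)
  have h1 : (fun q => part01 (delbar₀ r q)) = (delbar₀ r : Form1 E M) :=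
    funext fun q => part01_part01 _
  -- Of the two summands of `∂`, the (2,0) one vanishes on mixed pairs, so only `d∂̄r` remains.
  rw [ddbar, del₁, eval₂_add, eval₂_part20, eval₂_part11, zero_add, h1]
  rw [← eval₂_flatD_part01_fderiv (hC p x hx hxU)]
  have h2 := d₁_inChart (delbar₀ r) hx hdiff
  have h3 : flatD (fun y => part01 (Complex.ofRealCLM.comp (fderiv ℝ (r ∘ (chartAt E p).symm) y))) x
      = flatD (inChart (delbar₀ r) p) x := by
    rw [flatD, flatD]
    refine Filter.EventuallyEq.extDeriv_eq ?_
    filter_upwards [hev p x hx hxU] with y hy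
    rw [hy]
  rw [h3, ← h2]
  exact (eval₂_comp_holVec _ (chartSymmDeriv p x) _ (fun _ => rfl) v w).symm

end Hessian

/-! ### The dual norm of a functional. -/

section HermitianForms

variable {V : Type*} [AddCommGroup V] [Module ℂ V]

/-- The dual norm of the functional represented by `m` with respect to a positive definite
Hermitian form is the norm of `m`. -/
theorem sSup_norm_eq_sqrt {B : V →ₗ[ℂ] V →ₗ⋆[ℂ] ℂ} (hconj : ∀ v w, conj (B w v) = B v w)
    (hpos : ∀ v, v ≠ 0 → 0 < (B v v).re) {a : V → ℂ} {m : V} (ha : ∀ Z, a Z = B Z m) (hm : m ≠ 0) :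
    sSup {t : ℝ | ∃ Z, (B Z Z).re ≤ 1 ∧ t = ‖a Z‖} = √(B m m).re := by
  have hreal : ∀ v, ((B v v).re : ℂ) = B v v := fun v =>
    Complex.conj_eq_iff_re.1 (hconj v v)
  have hnn : ∀ v, 0 ≤ (B v v).re := fun v => by
    by_cases hv : v = 0
    · simp [hv]
    · exact (hpos v hv).le
  set s := (B m m).re with hs
  have hs0 : 0 < s := hpos m hm
  have hsC : B m m = (s : ℂ) := (hreal m).symm
  have hsne : (s : ℂ) ≠ 0 := Complex.ofReal_ne_zero.2 hs0.ne'
  -- Cauchy–Schwarz, from nonnegativity of `B` on the component of `Z` orthogonal to `m`.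
  have hcs : ∀ Z, ‖B Z m‖ ^ 2 ≤ (B Z Z).re * s := fun Z => by
    have h := hnn (Z - (B Z m / s) • m)
    have e : B (Z - (B Z m / s) • m) (Z - (B Z m / s) • m)
        = ((B Z Z).re - ‖B Z m‖ ^ 2 / s : ℝ) := by
      have hn : ((‖B Z m‖ ^ 2 : ℝ) : ℂ) = B Z m * conj (B Z m) := by
        rw [Complex.mul_conj, Complex.normSq_eq_norm_sq]
      simp only [map_sub, LinearMap.sub_apply, map_smul, LinearMap.smul_apply, map_smulₛₗ,
        smul_eq_mul, map_div₀, Complex.conj_ofReal, hsC, ← hconj m Z]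
      push_cast at hn ⊢
      rw [hn, hreal Z]
      field_simp
      ring
    rw [e, Complex.ofReal_re, sub_nonneg, div_le_iff₀ hs0] at h
    exact h
  -- The supremum is attained at the unit vector `m / √s`.
  refine IsGreatest.csSup_eq ⟨⟨((√s)⁻¹ : ℂ) • m, ?_, ?_⟩, ?_⟩
  · have hsq : √s * √s = s := Real.mul_self_sqrt hs0.le
    have : B (((√s)⁻¹ : ℂ) • m) (((√s)⁻¹ : ℂ) • m) = 1 := by
      simp only [map_smul, LinearMap.smul_apply, map_smulₛₗ, smul_eq_mul, hsC, map_inv₀,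
        Complex.conj_ofReal]
      rw [← mul_assoc, ← mul_inv, ← Complex.ofReal_mul, hsq, inv_mul_cancel₀ hsne]
    rw [this, Complex.one_re]
  · rw [ha, map_smul, LinearMap.smul_apply, hsC, smul_eq_mul, norm_mul, norm_inv,
      Complex.norm_real, Complex.norm_real, Real.norm_of_nonneg (Real.sqrt_nonneg _),
      Real.norm_of_nonneg hs0.le, inv_mul_eq_div, Real.div_sqrt]
  · rintro t ⟨Z, hZ, rfl⟩
    rw [ha]
    refine Real.le_sqrt_of_sq_le ((hcs Z).trans ?_)
    exact mul_le_of_le_one_left hs0.le hZ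

end HermitianForms

/-! ### The complex normal as a multiple of the gradient. -/

section NormalField

variable {E : Type*} [NormedAddCommGroup E] [NormedSpace ℂ E] [FiniteDimensional ℂ E]
variable {M : Type*} [TopologicalSpace M] [ChartedSpace E M]

/-- The real part of the metric in the chart around `p`. -/
def chartMetric (g : HermitianMetric E M) (p : M) (x : E) : E →L[ℝ] E →L[ℝ] ℝ :=
  LinearMap.toContinuousLinearMap ((LinearMap.toContinuousLinearMap (𝕜 := ℝ) (E := E) (F' := ℝ)).toLinearMap ∘ₗ
    LinearMap.mk₂ ℝ (fun w v : E => (g.inner ((chartAt E p).symm x) (chartSymmDeriv p x v)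
      (chartSymmDeriv p x w)).re)
      (fun w w' v => by simp only [map_add, Complex.add_re])
      (fun c w v => by
        rw [← Complex.coe_smul c w, map_smul, map_smulₛₗ, Complex.conj_ofReal, smul_eq_mul,
          Complex.re_ofReal_mul, smul_eq_mul])
      (fun w v v' => by simp only [map_add, LinearMap.add_apply, Complex.add_re])
      (fun c w v => by
        rw [← Complex.coe_smul c v, map_smul, map_smul, LinearMap.smul_apply, smul_eq_mul,
          Complex.re_ofReal_mul, smul_eq_mul]))

theorem chartMetric_apply (g : HermitianMetric E M) (p : M) (x w v : E) :
    chartMetric g p x w v = (g.inner ((chartAt E p).symm x) (chartSymmDeriv p x v)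
      (chartSymmDeriv p x w)).re := rfl

theorem contDiffOn_chartMetric (g : HermitianMetric E M) (p : M) :
    ContDiffOn ℝ ∞ (chartMetric g p) (chartAt E p).target :=
  contDiffOn_clm_apply.2 fun w => contDiffOn_clm_apply.2 fun v =>
    Complex.reCLM.contDiff.comp_contDiffOn (g.smooth p v w)

variable [IsManifold 𝓘(ℂ, E) ω M]

/-- Positive definiteness gives injectivity, and the dimensions of `E` and its real dual agree. -/
theorem chartMetric_isInvertible (g : HermitianMetric E M) {p : M} {x : E}
    (hx : x ∈ (chartAt E p).target) : (chartMetric g p x).IsInvertible := by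
  have hinj : Function.Injective (chartMetric g p x) := by
    rw [injective_iff_map_eq_zero]
    intro w hw
    by_contra hne
    obtain ⟨A', hA', -⟩ := exists_chartSymmDeriv_inverse hx
    have hAw : chartSymmDeriv p x w ≠ 0 := fun h => hne (by rw [← hA' w, h]; exact map_zero A')
    have h := g.pos _ _ hAw
    rw [← chartMetric_apply, hw] at h
    simp at h
  have hfin : Module.finrank ℝ E = Module.finrank ℝ (E →L[ℝ] ℝ) := by
    rw [← (LinearMap.toContinuousLinearMap (𝕜 := ℝ) (E := E) (F' := ℝ)).finrank_eq]
    exact Subspace.dual_finrank_eq.symm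
  have : FiniteDimensional ℝ (E →L[ℝ] ℝ) :=
    (LinearMap.toContinuousLinearMap (𝕜 := ℝ) (E := E) (F' := ℝ)).finiteDimensional
  let e : E ≃ₗ[ℝ] (E →L[ℝ] ℝ) := LinearEquiv.ofInjectiveOfFinrankEq
    (chartMetric g p x).toLinearMap hinj hfin
  refine ⟨e.toContinuousLinearEquiv, ?_⟩
  ext v w
  rfl

/-- The gradient of `ρ` with respect to the real part of the metric in the chart around `p`. -/
def chartGradient (g : HermitianMetric E M) (ρ : E → ℝ) (p : M) (x : E) : E :=
  (chartMetric g p x).inverse (fderiv ℝ ρ x)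

/-- The multiple `N` of the gradient of `ρ` with `∂ρ(N) = 1`. -/
def chartNormal (g : HermitianMetric E M) (ρ : E → ℝ) (p : M) (x : E) : E :=
  (2 / fderiv ℝ ρ x (chartGradient g ρ p x)) • chartGradient g ρ p x

variable {g : HermitianMetric E M} {ρ : E → ℝ} {p : M} {x : E}

theorem chartMetric_chartGradient (hx : x ∈ (chartAt E p).target) :
    chartMetric g p x (chartGradient g ρ p x) = fderiv ℝ ρ x :=
  ContinuousLinearMap.IsInvertible.self_apply_inverse (chartMetric_isInvertible g hx) _

/-- A complex-linear functional is determined by its real part, here `dρ`. The factor `2` arises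
because the real part of `∂ρ(Z_v)` is `dρ(v) / 2`. -/
theorem inner_chartGradient (hx : x ∈ (chartAt E p).target) (v : E) :
    g.inner ((chartAt E p).symm x) (chartSymmDeriv p x v)
      (chartSymmDeriv p x (chartGradient g ρ p x)) = 2 * covector10 (fderiv ℝ ρ x) v := by
  have h : ∀ v, fderiv ℝ ρ x v = (g.inner ((chartAt E p).symm x) (chartSymmDeriv p x v)
      (chartSymmDeriv p x (chartGradient g ρ p x))).re := fun v => by
    rw [← chartMetric_apply, chartMetric_chartGradient hx]
  have h2 : fderiv ℝ ρ x (Complex.I • v) = -(g.inner ((chartAt E p).symm x) (chartSymmDeriv p x v)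
      (chartSymmDeriv p x (chartGradient g ρ p x))).im := by
    rw [h, map_smul, map_smul, LinearMap.smul_apply, smul_eq_mul, Complex.I_mul_re]
  rw [covector10, h v, h2]
  apply Complex.ext <;> simp

theorem fderiv_chartGradient_pos (hx : x ∈ (chartAt E p).target) (hd : fderiv ℝ ρ x ≠ 0) :
    0 < fderiv ℝ ρ x (chartGradient g ρ p x) := by
  have hne : chartGradient g ρ p x ≠ 0 := fun h => hd (by
    rw [← chartMetric_chartGradient (g := g) hx, h, map_zero])
  obtain ⟨A', hA', -⟩ := exists_chartSymmDeriv_inverse hx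
  have hAw : chartSymmDeriv p x (chartGradient g ρ p x) ≠ 0 := fun h =>
    hne (by rw [← hA' (chartGradient g ρ p x), h]; exact map_zero A')
  have h := g.pos _ _ hAw
  rwa [← chartMetric_apply, chartMetric_chartGradient hx] at h

theorem covector10_chartGradient (hx : x ∈ (chartAt E p).target) :
    2 * covector10 (fderiv ℝ ρ x) (chartGradient g ρ p x)
      = (fderiv ℝ ρ x (chartGradient g ρ p x) : ℂ) := by
  rw [← inner_chartGradient hx, ← Complex.conj_eq_iff_re.1 (g.conj_symm _ _ _),
    ← chartMetric_apply, chartMetric_chartGradient hx]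

theorem covector10_chartNormal (hx : x ∈ (chartAt E p).target) (hd : fderiv ℝ ρ x ≠ 0) :
    covector10 (fderiv ℝ ρ x) (chartNormal g ρ p x) = 1 := by
  have h0 := Complex.ofReal_ne_zero.2 (fderiv_chartGradient_pos (g := g) hx hd).ne'
  rw [chartNormal, ← Complex.coe_smul, covector10_smul]
  have h := covector10_chartGradient (g := g) (ρ := ρ) hx
  push_cast
  rw [div_mul_eq_mul_div, h, div_self h0]

/-- Inversion is smooth at invertible maps, so the gradient has the regularity of `dρ`; the
denominator is positive by definiteness of the metric. -/
theorem contDiffAt_chartNormal (hx : x ∈ (chartAt E p).target) (hd : fderiv ℝ ρ x ≠ 0)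
    (hρ : ContDiffAt ℝ 2 ρ x) : ContDiffAt ℝ 1 (chartNormal g ρ p) x := by
  have h1 : ContDiffAt ℝ 1 (fderiv ℝ ρ) x := hρ.fderiv_right (by norm_num)
  have hK : ContDiffAt ℝ 1 (chartMetric g p) x :=
    ((contDiffOn_chartMetric g p).contDiffAt ((chartAt E p).open_target.mem_nhds hx)).of_le
      (by exact_mod_cast le_top)
  have hinv : ContDiffAt ℝ 1 (fun y => (chartMetric g p y).inverse) x :=
    ((chartMetric_isInvertible g hx).contDiffAt_map_inverse).comp x hK
  have hg : ContDiffAt ℝ 1 (chartGradient g ρ p) x := hinv.clm_apply h1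
  exact (contDiffAt_const.div (h1.clm_apply hg) (fderiv_chartGradient_pos hx hd).ne').smul hg

/-- The complex normal `L_r` in a chart. -/
theorem Lr_chart {U : Set M} {r : M → ℝ} {k : WithTop ℕ∞} (hk : k ≠ 0) (hU : IsOpen U)
    (hr : ContMDiffOn 𝓘(ℝ, E) 𝓘(ℝ, ℝ) k r U) (hx : x ∈ (chartAt E p).target)
    (hxU : (chartAt E p).symm x ∈ U) (hd : fderiv ℝ (r ∘ (chartAt E p).symm) x ≠ 0) :
    Lr g r ((chartAt E p).symm x)
      = chartSymmDeriv p x (chartNormal g (r ∘ (chartAt E p).symm) p x) := by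
  set q := (chartAt E p).symm x with hq
  set ρ := r ∘ (chartAt E p).symm with hρ
  set n := chartGradient g ρ p x with hn
  have hpos := fderiv_chartGradient_pos (g := g) hx hd
  set s := fderiv ℝ ρ x n with hs
  obtain ⟨A', hA', hA''⟩ := exists_chartSymmDeriv_inverse hx
  have hdel : ∀ v : E, eval₁ (del₀ r q) (holVec (chartSymmDeriv p x v)) = covector10 (fderiv ℝ ρ x) v :=
    fun v => eval₁_del₀_chart hk hU hr hx hxU v
  set m := ((1 / 2 : ℝ) : ℂ) • chartSymmDeriv p x n with hm
  have hinner : ∀ v : E, g.inner q (chartSymmDeriv p x v) (chartSymmDeriv p x n)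
      = 2 * covector10 (fderiv ℝ ρ x) v := inner_chartGradient hx
  have ha : ∀ Z : TangentSpace 𝓘(ℂ, E) q, eval₁ (del₀ r q) (holVec Z) = g.inner q Z m := by
    intro Z
    have hZ : chartSymmDeriv p x (A' Z) = Z := hA'' Z
    rw [← hZ, hdel, hm, map_smulₛₗ, Complex.conj_ofReal, hinner, smul_eq_mul]
    push_cast
    ring
  have hmm : g.inner q m m = ((s / 4 : ℝ) : ℂ) := by
    rw [← ha, hm, ← map_smul, hdel, covector10_smul]
    have := covector10_chartGradient (g := g) (ρ := ρ) hx
    rw [← hn, ← hs] at this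
    push_cast
    linear_combination (1 / 4 : ℂ) * this
  have hm0 : m ≠ 0 := by
    intro h0
    rw [h0, map_zero] at hmm
    have := Complex.ofReal_eq_zero.1 hmm.symm
    linarith
  have hN : normDel g r q = √(s / 4) := by
    rw [normDel, sSup_norm_eq_sqrt (g.conj_symm q) (g.pos q) ha hm0, hmm, Complex.ofReal_re]
  refine (existsUnique_isComplexNormal g r q).unique
    (existsUnique_isComplexNormal g r q).choose_spec.1 fun Z => ?_
  have hZ : chartSymmDeriv p x (A' Z) = Z := hA'' Z
  -- With `|∂r|⁻² = 4 / s`, the normal is `(4 / s) m`, that is, `2 / s` times the gradient.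
  rw [hN, Real.sq_sqrt (by positivity), ← hZ, hdel, chartNormal, ← Complex.coe_smul, map_smul,
    map_smulₛₗ, Complex.conj_ofReal, ← hn, hinner, smul_eq_mul, ← hs]
  have hs0 : (s : ℂ) ≠ 0 := Complex.ofReal_ne_zero.2 hpos.ne'
  push_cast
  field_simp
  ring

end NormalField

/-! ### The forms `α_r` and `β_r` in a chart. -/

section AlphaBeta

/-- In finite dimension a covector field is differentiable once its coefficients are. This applies
to `α`, which is known in the chart only through its values on fixed vectors. -/
theorem differentiableAt_of_differentiableAt_apply {E : Type*} [NormedAddCommGroup E]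
    [NormedSpace ℝ E] [FiniteDimensional ℝ E] {f : E → E →L[ℝ] ℂ} {x : E}
    (h : ∀ v, DifferentiableAt ℝ (fun y => f y v) x) : DifferentiableAt ℝ f x := by
  have hd : Module.finrank ℝ E = Module.finrank ℝ (Fin (Module.finrank ℝ E) → ℝ) :=
    (Module.finrank_fin_fun ℝ).symm
  let e₁ := ContinuousLinearEquiv.ofFinrankEq hd
  let e₂ := (e₁.arrowCongr (1 : ℂ ≃L[ℝ] ℂ)).trans
    (ContinuousLinearEquiv.piRing (Fin (Module.finrank ℝ E)))
  rw [← Function.id_comp f, ← e₂.symm_comp_self]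
  exact e₂.symm.differentiableAt.comp x (differentiableAt_pi.2 fun i => h _)

variable {E : Type*} [NormedAddCommGroup E] [NormedSpace ℂ E]

theorem part01_fderiv_conj {F : E → ℂ} {x : E} (hF : DifferentiableAt ℝ F x) (w : E) :
    part01 (fderiv ℝ (fun y => conj (F y)) x) w = conj (part10 (fderiv ℝ F x) w) := by
  have h : ∀ u, fderiv ℝ (fun y => conj (F y)) x u = conj (fderiv ℝ F x u) := fun u =>
    congrArg (fun G : E →L[ℝ] ℂ => G u)
      ((Complex.conjCLE.toContinuousLinearMap.hasFDerivAt.comp x hF.hasFDerivAt).fderiv)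
  rw [part01_apply, part10_apply, h, h]
  simp only [map_mul, map_sub, map_div₀, map_one, map_ofNat, Complex.conj_I]
  ring

variable {M : Type*} [TopologicalSpace M] [ChartedSpace E M]
variable {g : HermitianMetric E M} {U : Set M} {r : M → ℝ} {p : M} {x : E}

theorem inChart_part10 (a : Form1 E M) : inChart (fun q => part10 (a q)) p x = part10 (inChart a p x) := by
  ext v
  have h : inChart (fun q => part10 (a q)) p x v
    = part10 (a ((chartAt E p).symm x)) (chartSymmDeriv p x v) := rfl
  rw [h, part10_apply, part10_apply, ← map_smul]
  rfl

theorem inChart_part01 (a : Form1 E M) : inChart (fun q => part01 (a q)) p x = part01 (inChart a p x) := by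
  ext v
  have h : inChart (fun q => part01 (a q)) p x v
    = part01 (a ((chartAt E p).symm x)) (chartSymmDeriv p x v) := rfl
  rw [h, part01_apply, part01_apply, ← map_smul]
  rfl

variable [FiniteDimensional ℂ E]

/-- On a mixed pair the (2,0) and (0,2) parts drop out, so `∂α` sees only `d` of the (0,1) part of
`α`, and `∂̄α` only `d` of the (1,0) part. -/
theorem eval₂_beta_eq (g : HermitianMetric E M) (r : M → ℝ) (p : M)
    (Z W : TangentSpace 𝓘(ℂ, E) p) :
    eval₂ (beta g r p) (holVec Z) (conjVec (holVec W)) = -(Complex.I / 2) *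
      (eval₂ (d₁ (fun q => part01 (alpha g r q)) p) (holVec Z) (conjVec (holVec W))
        - eval₂ (d₁ (fun q => part10 (alpha g r q)) p) (holVec Z) (conjVec (holVec W))) := by
  rw [beta, eval₂_smul, eval₂_sub, del₁, delbar₁, eval₂_add, eval₂_add, eval₂_part20,
    eval₂_part02, eval₂_part11, eval₂_part11, zero_add, add_zero]

variable [IsManifold 𝓘(ℂ, E) ω M]

/-- The form `α_r` in a chart. -/
theorem inChart_alpha_apply {k : WithTop ℕ∞} (hk : 2 ≤ k) (hU : IsOpen U)
    (hr : ContMDiffOn 𝓘(ℝ, E) 𝓘(ℝ, ℝ) k r U) (hx : x ∈ (chartAt E p).target)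
    (hxU : (chartAt E p).symm x ∈ U) (hd : fderiv ℝ (r ∘ (chartAt E p).symm) x ≠ 0) (v : E) :
    inChart (alpha g r) p x v
      = hermitianPart (fderiv ℝ (fderiv ℝ (r ∘ (chartAt E p).symm)) x) v
          (chartNormal g (r ∘ (chartAt E p).symm) p x)
        + hermitianPart (fderiv ℝ (fderiv ℝ (r ∘ (chartAt E p).symm)) x)
          (chartNormal g (r ∘ (chartAt E p).symm) p x) v := by
  have hk0 : k ≠ 0 := fun h => by simp [h] at hk
  have h : inChart (alpha g r) p x v
      = eval₂ (ddbar r ((chartAt E p).symm x)) (holVec (chartSymmDeriv p x v))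
          (conjVec (holVec (Lr g r ((chartAt E p).symm x))))
        + eval₂ (ddbar r ((chartAt E p).symm x)) (holVec (Lr g r ((chartAt E p).symm x)))
          (conjVec (holVec (chartSymmDeriv p x v))) := rfl
  rw [h, Lr_chart hk0 hU hr hx hxU hd, eval₂_ddbar_chart hk hU hr hx hxU,
    eval₂_ddbar_chart hk hU hr hx hxU]

theorem part10_inChart_alpha_apply {k : WithTop ℕ∞} (hk : 2 ≤ k) (hU : IsOpen U)
    (hr : ContMDiffOn 𝓘(ℝ, E) 𝓘(ℝ, ℝ) k r U) (hx : x ∈ (chartAt E p).target)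
    (hxU : (chartAt E p).symm x ∈ U) (hd : fderiv ℝ (r ∘ (chartAt E p).symm) x ≠ 0) (v : E) :
    part10 (inChart (alpha g r) p x) v
      = hermitianPart (fderiv ℝ (fderiv ℝ (r ∘ (chartAt E p).symm)) x) v
          (chartNormal g (r ∘ (chartAt E p).symm) p x) := by
  rw [part10_apply, inChart_alpha_apply hk hU hr hx hxU hd, inChart_alpha_apply hk hU hr hx hxU hd,
    hermitianPart_smul_left, hermitianPart_smul_right, Complex.conj_I]
  linear_combination (1 / 2 : ℂ) * (-hermitianPart _ v _ + hermitianPart _ _ v) * Complex.I_sq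

theorem part01_inChart_alpha_apply {k : WithTop ℕ∞} (hk : 2 ≤ k) (hU : IsOpen U)
    (hr : ContMDiffOn 𝓘(ℝ, E) 𝓘(ℝ, ℝ) k r U) (hx : x ∈ (chartAt E p).target)
    (hxU : (chartAt E p).symm x ∈ U) (hd : fderiv ℝ (r ∘ (chartAt E p).symm) x ≠ 0) (v : E) :
    part01 (inChart (alpha g r) p x) v
      = hermitianPart (fderiv ℝ (fderiv ℝ (r ∘ (chartAt E p).symm)) x)
          (chartNormal g (r ∘ (chartAt E p).symm) p x) v := by
  rw [part01_apply, inChart_alpha_apply hk hU hr hx hxU hd, inChart_alpha_apply hk hU hr hx hxU hd,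
    hermitianPart_smul_left, hermitianPart_smul_right, Complex.conj_I]
  linear_combination (1 / 2 : ℂ) * (hermitianPart _ v _ - hermitianPart _ _ v) * Complex.I_sq

theorem fderiv_comp_chart_symm_eventually_ne_zero {k : WithTop ℕ∞} (hk : 2 ≤ k) (hU : IsOpen U)
    (hr : ContMDiffOn 𝓘(ℝ, E) 𝓘(ℝ, ℝ) k r U) (hpU : p ∈ U)
    (hd : fderiv ℝ (r ∘ (chartAt E p).symm) (chartAt E p p) ≠ 0) :
    ∀ᶠ y in 𝓝 (chartAt E p p), y ∈ (chartAt E p).target ∧ (chartAt E p).symm y ∈ U ∧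
      fderiv ℝ (r ∘ (chartAt E p).symm) y ≠ 0 := by
  have hs : (chartAt E p).symm (chartAt E p p) = p := (chartAt E p).left_inv (mem_chart_source E p)
  have hxU : (chartAt E p).symm (chartAt E p p) ∈ U := by rwa [hs]
  have hx := mem_chart_target E p
  have hC := (contDiffAt_comp_chart_symm hU hr hx hxU).of_le hk
  have hc : ContinuousAt (fderiv ℝ (r ∘ (chartAt E p).symm)) (chartAt E p p) :=
    (hC.fderiv_right (m := 1) (by norm_num)).continuousAt
  filter_upwards [(chartAt E p).open_target.mem_nhds hx,
    ((chartAt E p).symm.continuousAt hx).eventually (hU.mem_nhds hxU), hc.eventually_ne hd]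
    with y h1 h2 h3
  exact ⟨h1, h2, h3⟩

/-- The value of `α_r` on a vector of type `(1,0)`. -/
theorem eval₁_alpha {k : WithTop ℕ∞} (hk : 2 ≤ k) (hU : IsOpen U)
    (hr : ContMDiffOn 𝓘(ℝ, E) 𝓘(ℝ, ℝ) k r U) (hpU : p ∈ U)
    (hd : fderiv ℝ (r ∘ (chartAt E p).symm) (chartAt E p p) ≠ 0) (Z : E) :
    eval₁ (T := E) (alpha g r p) (holVec Z)
      = hermitianPart (fderiv ℝ (fderiv ℝ (r ∘ (chartAt E p).symm)) (chartAt E p p)) Z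
          (chartNormal g (r ∘ (chartAt E p).symm) p (chartAt E p p)) := by
  obtain ⟨hx, hxU, -⟩ := (fderiv_comp_chart_symm_eventually_ne_zero hk hU hr hpU hd).self_of_nhds
  rw [← part10_inChart_alpha_apply hk hU hr hx hxU hd]
  let a : M → E →L[ℝ] ℂ := alpha g r
  have h : inChart (alpha g r) p (chartAt E p p) = (a ((chartAt E p).symm (chartAt E p p))).comp
    ((chartSymmDeriv p (chartAt E p p) : E →L[ℂ] E).restrictScalars ℝ) := rfl
  have h2 : inChart (alpha g r) p (chartAt E p p) = a p := by
    rw [h, chartSymmDeriv_chartAt, (chartAt E p).left_inv (mem_chart_source E p)]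
    rfl
  rw [h2]
  exact eval₁_holVec (a p) Z

/-- The component of `β_r` of type `(1,1)` in a chart. -/
theorem eval₂_beta (hU : IsOpen U)
    (hr : ContMDiffOn 𝓘(ℝ, E) 𝓘(ℝ, ℝ) 3 r U) (hpU : p ∈ U)
    (hd : fderiv ℝ (r ∘ (chartAt E p).symm) (chartAt E p p) ≠ 0) (Z W : E) :
    eval₂ (T := E) (beta g r p) (holVec Z) (conjVec (holVec W))
      = -(Complex.I / 2) *
        (part10 (fderiv ℝ (fun y => hermitianPart (fderiv ℝ (fderiv ℝ (r ∘ (chartAt E p).symm)) y)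
            (chartNormal g (r ∘ (chartAt E p).symm) p y) W) (chartAt E p p)) Z
          + conj (part10 (fderiv ℝ (fun y => hermitianPart
            (fderiv ℝ (fderiv ℝ (r ∘ (chartAt E p).symm)) y)
            (chartNormal g (r ∘ (chartAt E p).symm) p y) Z) (chartAt E p p)) W)) := by
  set ρ := r ∘ (chartAt E p).symm with hρ
  set x₀ := chartAt E p p with hx₀
  have h23 : (2 : WithTop ℕ∞) ≤ 3 := by norm_num
  have hgood := fderiv_comp_chart_symm_eventually_ne_zero h23 hU hr hpU hd
  obtain ⟨hx, hxU, -⟩ := hgood.self_of_nhds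
  have hC : ContDiffAt ℝ 3 ρ x₀ := contDiffAt_comp_chart_symm hU hr hx hxU
  have hD2 : ContDiffAt ℝ 1 (fderiv ℝ (fderiv ℝ ρ)) x₀ :=
    (hC.fderiv_right (m := 2) (by norm_num)).fderiv_right (by norm_num)
  have hn : ContDiffAt ℝ 1 (chartNormal g ρ p) x₀ := contDiffAt_chartNormal hx hd (hC.of_le h23)
  have hl : ∀ v, DifferentiableAt ℝ
      (fun y => hermitianPart (fderiv ℝ (fderiv ℝ ρ) y) (chartNormal g ρ p y) v) x₀ := fun v =>
    (contDiffAt_hermitianPart hD2 hn contDiffAt_const).differentiableAt one_ne_zero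
  have hrt : ∀ v, DifferentiableAt ℝ
      (fun y => hermitianPart (fderiv ℝ (fderiv ℝ ρ) y) v (chartNormal g ρ p y)) x₀ := fun v =>
    (contDiffAt_hermitianPart hD2 contDiffAt_const hn).differentiableAt one_ne_zero
  have e01 : ∀ v, (fun y => inChart (fun q => part01 (alpha g r q)) p y v) =ᶠ[𝓝 x₀]
      fun y => hermitianPart (fderiv ℝ (fderiv ℝ ρ) y) (chartNormal g ρ p y) v := fun v => by
    filter_upwards [hgood] with y hy
    rw [inChart_part01, part01_inChart_alpha_apply h23 hU hr hy.1 hy.2.1 hy.2.2]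
  have e10 : ∀ v, (fun y => inChart (fun q => part10 (alpha g r q)) p y v) =ᶠ[𝓝 x₀]
      fun y => hermitianPart (fderiv ℝ (fderiv ℝ ρ) y) v (chartNormal g ρ p y) := fun v => by
    filter_upwards [hgood] with y hy
    rw [inChart_part10, part10_inChart_alpha_apply h23 hU hr hy.1 hy.2.1 hy.2.2]
  have d01 : DifferentiableAt ℝ (inChart (fun q => part01 (alpha g r q)) p) x₀ :=
    differentiableAt_of_differentiableAt_apply fun v => (hl v).congr_of_eventuallyEq (e01 v)
  have d10 : DifferentiableAt ℝ (inChart (fun q => part10 (alpha g r q)) p) x₀ :=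
    differentiableAt_of_differentiableAt_apply fun v => (hrt v).congr_of_eventuallyEq (e10 v)
  have f01 := eval₂_flatD_of_antilinear d01
    (.of_forall fun y v => by rw [inChart_part01, part01_I_smul]) Z W
  have f10 := eval₂_flatD_of_linear d10
    (.of_forall fun y v => by rw [inChart_part10, part10_I_smul]) Z W
  rw [(e01 W).fderiv_eq] at f01
  -- Hermitian symmetry turns the `∂̄_W`-derivative of `H(Z, N̄)` into the conjugate of the
  -- `∂_W`-derivative of `H(N, Z̄)`, so a single type of derivative occurs, with `Z` and `W`
  -- exchanged.
  have hconj : (fun y => hermitianPart (fderiv ℝ (fderiv ℝ ρ) y) Z (chartNormal g ρ p y)) =ᶠ[𝓝 x₀]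
      fun y => conj (hermitianPart (fderiv ℝ (fderiv ℝ ρ) y) (chartNormal g ρ p y) Z) := by
    filter_upwards [hgood] with y hy
    rw [hermitianPart_conj (fderiv_fderiv_comm
      ((contDiffAt_comp_chart_symm hU hr hy.1 hy.2.1).of_le h23))]
  rw [(e10 Z).fderiv_eq, hconj.fderiv_eq, part01_fderiv_conj (hl Z)] at f10
  rw [← d₁_eq] at f01 f10
  refine (eval₂_beta_eq g r p Z W).trans ?_
  erw [f01, f10]
  rw [sub_neg_eq_add]

end AlphaBeta

/-! ### Boundary, null space and pseudoconvexity in a chart. -/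

section Domains

variable {E : Type*} [NormedAddCommGroup E] [NormedSpace ℂ E]
variable {M : Type*} [TopologicalSpace M] [ChartedSpace E M]
variable {Ω U : Set M} {r : M → ℝ} {p : M}

theorem IsDefiningFunction.of_le {k l : WithTop ℕ∞} (h : IsDefiningFunction E k Ω U r)
    (hl : l ≤ k) : IsDefiningFunction E l Ω U r :=
  { h with contMDiffOn := h.contMDiffOn.of_le hl }

/-- The sign conditions exclude zeros in `Ω` and outside its closure. This makes the zero set in `U`
equal to `∂Ω`, so that the Levi condition holds along a full level set. -/
theorem IsDefiningFunction.mem_frontier {k : WithTop ℕ∞} (h : IsDefiningFunction E k Ω U r)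
    (hΩ : IsOpen Ω) (hpU : p ∈ U) (hp : r p = 0) : p ∈ frontier Ω := by
  rw [hΩ.frontier_eq]
  refine ⟨?_, fun hpΩ => (h.neg p ⟨hpU, hpΩ⟩).ne hp⟩
  by_contra hc
  exact (h.pos p ⟨hpU, hc⟩).ne' hp

variable [IsManifold 𝓘(ℂ, E) ω M]

theorem IsDefiningFunction.fderiv_chart_ne_zero {k : WithTop ℕ∞} (h : IsDefiningFunction E k Ω U r)
    (hp : p ∈ frontier Ω) : fderiv ℝ (r ∘ (chartAt E p).symm) (chartAt E p p) ≠ 0 := fun h0 =>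
  h.d_ne_zero p hp (by
    refine (d₀_eq (E := E) r p).trans ?_
    rw [h0, ContinuousLinearMap.comp_zero]
    rfl)

/-- At the base point the chart has identity derivative, so vectors are unchanged, and the intrinsic
null space may be tested with `r` itself. -/
theorem leviNull_subset_flatLeviNull (h : IsDefiningFunction E 2 Ω U r) (hp : p ∈ frontier Ω)
    {Z : E} (hZ : Z ∈ leviNull (E := E) Ω p) :
    Z ∈ flatLeviNull (r ∘ (chartAt E p).symm) (chartAt E p p) := by
  have hs : (chartAt E p).symm (chartAt E p p) = p := (chartAt E p).left_inv (mem_chart_source E p)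
  have hxU : (chartAt E p).symm (chartAt E p p) ∈ U := by rw [hs]; exact h.frontier_subset hp
  have hx := mem_chart_target E p
  obtain ⟨h1, h2⟩ := hZ U r h
  have htan : ∀ v : E, eval₁ (T := E) (del₀ r p) (holVec v)
      = covector10 (fderiv ℝ (r ∘ (chartAt E p).symm) (chartAt E p p)) v := fun v => by
    let a : M → E →L[ℝ] ℂ := del₀ r
    have e : eval₁ (a ((chartAt E p).symm (chartAt E p p)))
      (holVec ((chartSymmDeriv p (chartAt E p p) : E →L[ℂ] E) v)) = _ :=
      eval₁_del₀_chart two_ne_zero h.isOpen h.contMDiffOn hx hxU v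
    rw [chartSymmDeriv_chartAt, hs] at e
    exact e
  have hlevi : ∀ v w : E, eval₂ (T := E) (ddbar r p) (holVec v) (conjVec (holVec w))
      = hermitianPart (fderiv ℝ (fderiv ℝ (r ∘ (chartAt E p).symm)) (chartAt E p p)) v w :=
    fun v w => by
    let b : M → E [⋀^Fin 2]→L[ℝ] ℂ := ddbar r
    have e : eval₂ (b ((chartAt E p).symm (chartAt E p p)))
      (holVec ((chartSymmDeriv p (chartAt E p p) : E →L[ℂ] E) v))
      (conjVec (holVec ((chartSymmDeriv p (chartAt E p p) : E →L[ℂ] E) w))) = _ :=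
      eval₂_ddbar_chart le_rfl h.isOpen h.contMDiffOn hx hxU v w
    rw [chartSymmDeriv_chartAt, hs] at e
    exact e
  exact ⟨(htan Z).symm.trans h1, fun V hV => (hlevi Z V).symm.trans (h2 V ((htan V).trans hV))⟩

/-- Near `P` the level set of `ρ` through `P` consists of boundary points, and at each of them
pseudoconvexity applies with the same defining function. -/
theorem IsPseudoconvex.eventually_nonneg (hpsc : IsPseudoconvex E Ω) (hΩ : IsOpen Ω)
    (h : IsDefiningFunction E 2 Ω U r) (hp : p ∈ frontier Ω) :
    ∀ᶠ y in 𝓝 (chartAt E p p),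
      (r ∘ (chartAt E p).symm) y = (r ∘ (chartAt E p).symm) (chartAt E p p) →
      ∀ v, covector10 (fderiv ℝ (r ∘ (chartAt E p).symm) y) v = 0 →
        0 ≤ (hermitianPart (fderiv ℝ (fderiv ℝ (r ∘ (chartAt E p).symm)) y) v v).re := by
  have hs : (chartAt E p).symm (chartAt E p p) = p := (chartAt E p).left_inv (mem_chart_source E p)
  have hxU : (chartAt E p).symm (chartAt E p p) ∈ U := by rw [hs]; exact h.frontier_subset hp
  have hx := mem_chart_target E p
  filter_upwards [(chartAt E p).open_target.mem_nhds hx,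
    ((chartAt E p).symm.continuousAt hx).eventually (h.isOpen.mem_nhds hxU)] with y hy hyU hlev v hv
  rw [Function.comp_apply, Function.comp_apply, hs, h.zero p hp] at hlev
  rw [← eval₂_ddbar_chart le_rfl h.isOpen h.contMDiffOn hy hyU]
  refine hpsc U r h _ (h.mem_frontier hΩ hyU hlev) _ ?_
  rw [holTangent, mem_ofPred_eq, eval₁_del₀_chart two_ne_zero h.isOpen h.contMDiffOn hy hyU, hv]

end Domains

end LeviGeometry

end

/-! ### Comparison of the two metrics. -/

open LeviGeometry in
theorem lemma6p3
    {E : Type*} [NormedAddCommGroup E] [NormedSpace ℂ E] [FiniteDimensional ℂ E]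
    (hn : 2 ≤ Module.finrank ℂ E)
    {M : Type*} [TopologicalSpace M] [T2Space M] [SecondCountableTopology M] [ChartedSpace E M]
    [IsManifold 𝓘(ℂ, E) ω M]
    (Ω : Set M) (hΩ_open : IsOpen Ω) (hΩ_conn : IsConnected Ω) (hΩ_cpt : IsCompact (closure Ω))
    (hΩ_psc : IsPseudoconvex E Ω)
    (U : Set M) (r : M → ℝ) (hr : IsDefiningFunction E 3 Ω U r)
    (g₀ g₁ : HermitianMetric E M)
    (P : M) (hP : P ∈ frontier Ω)
    (Z W : TangentSpace 𝓘(ℂ, E) P) (hZ : Z ∈ leviNull Ω P) (hW : W ∈ leviNull Ω P) :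
    eval₁ (alpha g₁ r P) (holVec Z) = eval₁ (alpha g₀ r P) (holVec Z) ∧
      eval₂ (beta g₁ r P) (holVec Z) (conjVec (holVec W)) =
        eval₂ (beta g₀ r P) (holVec Z) (conjVec (holVec W)) := by
  have h23 : (2 : WithTop ℕ∞) ≤ 3 := by norm_num
  have hr2 : IsDefiningFunction E 2 Ω U r := hr.of_le h23
  have hPU := hr.frontier_subset hP
  have hd := hr.fderiv_chart_ne_zero hP
  have hZ' := leviNull_subset_flatLeviNull hr2 hP hZ
  have hW' := leviNull_subset_flatLeviNull hr2 hP hW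
  have hpsc := hΩ_psc.eventually_nonneg hΩ_open hr2 hP
  have hgood := fderiv_comp_chart_symm_eventually_ne_zero h23 hr.isOpen hr.contMDiffOn hPU hd
  obtain ⟨hx, hxU, -⟩ := hgood.self_of_nhds
  have hC := contDiffAt_comp_chart_symm hr.isOpen hr.contMDiffOn hx hxU
  have hN : ∀ g : HermitianMetric E M, ContDiffAt ℝ 1
      (chartNormal g (r ∘ (chartAt E P).symm) P) (chartAt E P P) := fun g =>
    contDiffAt_chartNormal hx hd (hC.of_le h23)
  have hN1 : ∀ g : HermitianMetric E M, ∀ᶠ y in 𝓝 (chartAt E P P),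
      covector10 (fderiv ℝ (r ∘ (chartAt E P).symm) y)
        (chartNormal g (r ∘ (chartAt E P).symm) P y) = 1 := fun g => by
    filter_upwards [hgood] with y hy
    exact covector10_chartNormal hy.1 hy.2.2
  have : CompleteSpace E := FiniteDimensional.complete ℂ E
  constructor
  · refine (eval₁_alpha h23 hr.isOpen hr.contMDiffOn hPU hd Z).trans
      (Eq.trans ?_ (eval₁_alpha h23 hr.isOpen hr.contMDiffOn hPU hd Z).symm)
    -- The value on the second normal is expressed through the first, with coefficient the conjugate
    -- of `∂ρ(N₁) = 1`.
    rw [hermitianPart_of_mem_flatLeviNull hZ' (hN1 g₀).self_of_nhds, (hN1 g₁).self_of_nhds,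
      map_one, one_mul]
  · refine (eval₂_beta hr.isOpen hr.contMDiffOn hPU hd Z W).trans
      (Eq.trans ?_ (eval₂_beta hr.isOpen hr.contMDiffOn hPU hd Z W).symm)
    -- The two summands of `β` are the same expression with `Z` and `W` exchanged, so the comparison
    -- is used once in each order.
    rw [part10_fderiv_hermitianPart_normal_eq hC hd (hN g₀) (hN g₁) (hN1 g₀) (hN1 g₁) hpsc hZ' hW',
      part10_fderiv_hermitianPart_normal_eq hC hd (hN g₀) (hN g₁) (hN1 g₀) (hN1 g₁) hpsc hW' hZ']
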